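/- Let $\Sigma=\{0,1\}$. For an oracle $O\subseteq\Sigma^*$ let $\mathrm{FP}^O$ be the class of total functions $\Sigma^*\to\Sigma^*$ that are computable in polynomial time by a deterministic Turing machine with oracle $O$. Relative to $O$, consider the following classes of equivalence relations $R$ on $\Sigma^*$: - $\mathrm{PEq}^O$: those $R$ for which "given $x,y\in\Sigma^*$, does $x\sim_R y$ hold?" is decidable in polynomial time by a deterministic Turing machine with oracle $O$; - $\mathrm{Ker}^O$: those $R$ that have a complete invariant in $\mathrm{FP}^O$, i.e. some $f\in\mathrm{FP}^O$ such that $x\sim_R y \iff f(x)=f(y)$ for all $x,y$; - $\mathrm{CF}^O$: those $R$ that have a canonical form in $\mathrm{FP}^O$, i.e. a complete invariant $f\in\mathrm{FP}^O$ with $x\sim_R f(x)$ for all $x$. Let $\mathrm{Ker}^O_p$ and $\mathrm{CF}^O_p$ be the classes of those $R$ in $\mathrm{Ker}^O$ and $\mathrm{CF}^O$, respectively, that are polynomially bounded: for some polynomial $q$, $x\sim_R y$ implies $|x|\le q(|y|)$. Theorem. There is an oracle $O$ such that $\mathrm{CF}^O\ne\mathrm{Ker}^O$ and $\mathrm{Ker}^O\ne\mathrm{PEq}^O$.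 There is also an oracle $O$ such that $\mathrm{CF}^O_p=\mathrm{Ker}^O_p$ and $\mathrm{Ker}^O\ne\mathrm{PEq}^O$. -/

import Mathlib

/-!
Relativized complexity classes of equivalence problems over the binary alphabet, based on
deterministic multi-tape oracle Turing machines with tape alphabet `{0, 1, blank}`.
Words are `List Bool`, oracles are sets of words, and the tape alphabet is `Option Bool`,
with `none` as the blank symbol.
-/

namespace EqProblems

/-- The instruction attached to a state of an oracle Turing machine with `k + 2` tapes and
`s + 1` states. -/
inductive Instr (k s : ℕ) : Type
  /-- Stop. -/
  | halt : Instr k s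
  /-- A query state: continue in state `yes` if the word on the query tape belongs to the oracle,
  and in state `no` otherwise. -/
  | query (yes no : Fin (s + 1)) : Instr k s
  /-- An ordinary state: depending on the symbols under the heads, go to a new state, and on each
  tape write a symbol and then move the head one cell, or leave it in place (`none`). -/
  | act (next : (Fin (k + 2) → Option Bool) →
      Fin (s + 1) × (Fin (k + 2) → Option Bool × Option Turing.Dir)) : Instr k s

/-- A deterministic oracle Turing machine with `work + 2` tapes and `maxState + 1` states, the
initial state being `0`. Tape `0` holds the input and, at the end, the output; tape `1` is the
query tape. -/
structure OracleTM : Type where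
  work : ℕ
  maxState : ℕ
  instr : Fin (maxState + 1) → Instr work maxState

/-- The word `w` is written on the tape `T`, starting from the cell under the head, and all cells
to the right of it are blank. -/
def Holds (T : Turing.Tape (Option Bool)) (w : List Bool) : Prop :=
  T.right₀ = Turing.ListBlank.mk (w.map some)

/-- Write a symbol, then move the head or leave it in place. -/
def tapeAct (T : Turing.Tape (Option Bool)) (a : Option Bool × Option Turing.Dir) :
    Turing.Tape (Option Bool) :=
  match a.2 with
  | none => T.write a.1
  | some d => (T.write a.1).move d

namespace OracleTM

/-- A configuration: the state and the contents of the tapes, with head positions. -/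
structure Cfg (M : OracleTM) : Type where
  state : Fin (M.maxState + 1)
  tape : Fin (M.work + 2) → Turing.Tape (Option Bool)

/-- The initial configuration: the input is on tape `0`, with the head on its first symbol, and
the other tapes are blank. -/
def init (M : OracleTM) (x : List Bool) : M.Cfg where
  state := 0
  tape i := if i = 0 then Turing.Tape.mk₁ (x.map some) else Turing.Tape.mk₁ []

open Classical in
/-- One step of the machine with oracle `O`; a halted configuration does not change. -/
noncomputable def step (M : OracleTM) (O : Set (List Bool)) (c : M.Cfg) : M.Cfg :=
  match M.instr c.state with
  | .halt => c
  | .query yes no => ⟨if ∃ w ∈ O, Holds (c.tape 1) w then yes else no, c.tape⟩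
  | .act next =>
      let a := next fun i => (c.tape i).head
      ⟨a.1, fun i => tapeAct (c.tape i) (a.2 i)⟩

/-- With oracle `O` and input `x`, the machine halts after at most `t` steps, with output `y`. -/
def Outputs (M : OracleTM) (O : Set (List Bool)) (t : ℕ) (x y : List Bool) : Prop :=
  let c := (M.step O)^[t] (M.init x)
  M.instr c.state = .halt ∧ Holds (c.tape 0) y

end OracleTM

/-- `FP O`: the total functions computed in polynomial time by a machine with oracle `O`. -/
def FP (O : Set (List Bool)) : Set (List Bool → List Bool) :=
  {f | ∃ (M : OracleTM) (p : Polynomial ℕ), ∀ x, M.Outputs O (p.eval x.length) x (f x)}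

/-- An injective encoding of pairs of words: each bit of `x` is doubled, then comes the separator
`01`, then `y`. -/
def pair (x y : List Bool) : List Bool :=
  x.flatMap (fun b => [b, b]) ++ false :: true :: y

/-- `PEq O`: the equivalence relations whose recognition problem "given `x` and `y`, decide
whether `x ∼ y`" is solved in polynomial time by a machine with oracle `O`, which outputs the
one-letter word `1` for "yes" and `0` for "no". -/
def PEq (O : Set (List Bool)) : Set (Setoid (List Bool)) :=
  {R | ∃ (M : OracleTM) (p : Polynomial ℕ), ∀ x y,
    (R x y → M.Outputs O (p.eval (pair x y).length) (pair x y) [true]) ∧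
    (¬ R x y → M.Outputs O (p.eval (pair x y).length) (pair x y) [false])}

/-- `f` is a complete invariant for `R`. -/
def IsCompleteInvariant (R : Setoid (List Bool)) (f : List Bool → List Bool) : Prop :=
  ∀ x y, R x y ↔ f x = f y

/-- `f` is a canonical form for `R`. -/
def IsCanonicalForm (R : Setoid (List Bool)) (f : List Bool → List Bool) : Prop :=
  IsCompleteInvariant R f ∧ ∀ x, R x (f x)

/-- `Ker O`: the equivalence relations with a complete invariant in `FP O`. -/
def Ker (O : Set (List Bool)) : Set (Setoid (List Bool)) :=
  {R | ∃ f ∈ FP O, IsCompleteInvariant R f}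

/-- `CF O`: the equivalence relations with a canonical form in `FP O`. -/
def CF (O : Set (List Bool)) : Set (Setoid (List Bool)) :=
  {R | ∃ f ∈ FP O, IsCanonicalForm R f}

/-- The polynomially bounded equivalence relations. -/
def PolyBounded : Set (Setoid (List Bool)) :=
  {R | ∃ p : Polynomial ℕ, ∀ x y, R x y → x.length ≤ p.eval y.length}

/-- The polynomially bounded relations in `Ker O`. -/
def KerP (O : Set (List Bool)) : Set (Setoid (List Bool)) := Ker O ∩ PolyBounded

/-- The polynomially bounded relations in `CF O`. -/
def CFP (O : Set (List Bool)) : Set (Setoid (List Bool)) := CF O ∩ PolyBounded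

end EqProblems

namespace EqProblems

open Turing

/-! The oracle encodes hidden sets of words `A false` and `A true`, and its bits spell out the
values of prescribed functions so that a simple machine can read them off (`mem_FP_of_script`).
Function 0 decides `hiddenRel A false`, which puts this relation in `PEq`; function 1 is a complete
invariant of `hiddenRel A true`; the others compute canonical words for a list of machines. The
canonical words depend on the oracle itself. The circle is broken by idle rounds, whose answers
carry no information: an informative query is longer than every query in the runs it depends on.

The hidden sets are built by finite extensions (`exists_hidden`). To defeat a machine, a length `n`
is taken at which its time bound is far below `2 ^ n`, and perhaps two words `a`, `b` of that length
are made equivalent. A run sees few oracle bits, so if each bit changes for few choices of `(a, b)`,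
counting (`exists_mutually_avoiding`) gives a pair whose addition is unnoticed by the runs on `a`
and on `b`. An alleged invariant of `hiddenRel A false` is refuted by adding the pair exactly when
the two outputs differ. An alleged canonical form of `hiddenRel A true` has to name `a` or `b` on
both inputs, but it cannot guess the partner of its input, so its two outputs cannot coincide. The
first oracle uses an empty list of machines.

For the second oracle all machines are listed, and the canonical words must not betray the pair. The
least word with the same output as `x` would not do, since it depends on exponentially many runs.
Instead candidates are tested against the oracle for the data truncated at `m`, only the first
candidate is checked against the true oracle, and `m` increases until the check succeeds. A pair of
length `n` is invisible to truncations at `m ≤ n`, and without the pair the search succeeds by `m =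
n`; so only the runs on `x` and on at most `n + 1` first candidates matter (`canon_addPair`).
Induction on the query length then bounds the exceptional pairs of each bit by a quadratic
polynomial (`oracle_addPair_false`). For a machine computing an invariant of a polynomially bounded
relation, the search depends only on the class of `x`, hence gives a canonical form
(`mem_CF_of_mach`). -/

/-! ### Countability of machines and time bounds -/

instance : Finite Turing.Dir :=
  Finite.of_injective (fun d => decide (d = Turing.Dir.left)) (by
    intro a b; cases a <;> cases b <;> simp)

instance (k s : ℕ) : Finite (Instr k s) := by
  let g : Instr k s → Option ((Fin (s + 1) × Fin (s + 1)) ⊕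
      ((Fin (k + 2) → Option Bool) →
        Fin (s + 1) × (Fin (k + 2) → Option Bool × Option Turing.Dir))) := fun i =>
    match i with
    | .halt => none
    | .query a b => some (.inl (a, b))
    | .act f => some (.inr f)
  refine Finite.of_injective g ?_
  intro a b h
  cases a <;> cases b <;> simp_all [g]

instance : Countable OracleTM := by
  let g : OracleTM → Σ k : ℕ, Σ s : ℕ, (Fin (s + 1) → Instr k s) := fun M =>
    ⟨M.work, M.maxState, M.instr⟩
  refine Function.Injective.countable (f := g) ?_
  rintro ⟨k, s, i⟩ ⟨k', s', i'⟩ h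
  simp only [g, Sigma.mk.injEq] at h
  obtain ⟨rfl, h⟩ := h
  simp only [heq_eq_eq, Sigma.mk.injEq] at h
  obtain ⟨rfl, h⟩ := h
  simp only [heq_eq_eq] at h
  rw [h]

instance : Nonempty OracleTM := ⟨⟨0, 0, fun _ => .halt⟩⟩

instance : Countable (Polynomial ℕ) :=
  Function.Injective.countable (f := fun p : Polynomial ℕ => p.toFinsupp.coeff) (by
    intro a b h; ext n; exact DFunLike.congr_fun h n)

/-! ### Tapes -/

theorem nth_mk_map_some (w : List Bool) (n : ℕ) :
    (ListBlank.mk (w.map some)).nth n = w[n]? := by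
  rw [ListBlank.nth_mk, List.getI_eq_getElem?_getD]
  rw [List.getElem?_map]
  cases w[n]? <;> rfl

theorem mk_map_some_injective :
    Function.Injective fun w : List Bool => ListBlank.mk (w.map some) := by
  intro w v h
  apply List.ext_getElem?
  intro n
  rw [← nth_mk_map_some, ← nth_mk_map_some]
  exact congrArg (fun L => ListBlank.nth L n) h

theorem Holds.unique {T : Tape (Option Bool)} {w v : List Bool} (hw : Holds T w)
    (hv : Holds T v) : w = v :=
  mk_map_some_injective (hw.symm.trans hv)

theorem holds_mk' {L : ListBlank (Option Bool)} {u w : List Bool} :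
    Holds (Tape.mk' L (ListBlank.mk (u.map some))) w ↔ w = u := by
  unfold Holds
  rw [Tape.mk'_right₀]
  exact ⟨fun h => (mk_map_some_injective h).symm, fun h => by rw [h]⟩

/-- All cells at distance at least `n` to the right of the head are blank. -/
def BlankFrom (n : ℕ) (T : Tape (Option Bool)) : Prop := ∀ m, n ≤ m → T.right₀.nth m = none

theorem Holds.length_le {T : Tape (Option Bool)} {w : List Bool} {n : ℕ} (hw : Holds T w)
    (hT : BlankFrom n T) : w.length ≤ n := by
  by_contra! h
  have := hT n le_rfl
  rw [hw, nth_mk_map_some, List.getElem?_eq_none_iff] at this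
  omega

theorem BlankFrom.tapeAct {T : Tape (Option Bool)} {n : ℕ} (hn : 1 ≤ n) (hT : BlankFrom n T)
    (a : Option Bool × Option Turing.Dir) : BlankFrom (n + 1) (tapeAct T a) := by
  obtain ⟨L, R, rfl⟩ := T.exists_mk'
  obtain ⟨b, d⟩ := a
  have hR : ∀ m, n ≤ m → R.nth m = none := by simpa [BlankFrom] using hT
  intro m hm
  obtain ⟨m, rfl⟩ : ∃ k, m = k + 2 := ⟨m - 2, by omega⟩
  match d with
  | none =>
    simp only [EqProblems.tapeAct, Tape.write_mk', Tape.mk'_right₀, ListBlank.nth_succ,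
      ListBlank.tail_cons]
    simpa [ListBlank.nth_succ] using hR (m + 2) (by omega)
  | some .left =>
    simp only [EqProblems.tapeAct, Tape.write_mk', Tape.move_left_mk', Tape.mk'_right₀,
      ListBlank.nth_succ, ListBlank.tail_cons]
    simpa [ListBlank.nth_succ] using hR (m + 1) (by omega)
  | some .right =>
    simp only [EqProblems.tapeAct, Tape.write_mk', Tape.move_right_mk', Tape.mk'_right₀,
      ListBlank.nth_succ, ListBlank.tail_cons]
    simpa [ListBlank.nth_succ] using hR (m + 3) (by omega)

/-! ### Runs of oracle machines -/

namespace OracleTM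

variable (M : OracleTM) (O : Set (List Bool))

/-- The configuration reached after `t` steps on input `x`. -/
noncomputable def run (t : ℕ) (x : List Bool) : M.Cfg := (M.step O)^[t] (M.init x)

theorem run_succ (t : ℕ) (x : List Bool) : M.run O (t + 1) x = M.step O (M.run O t x) :=
  Function.iterate_succ_apply' _ _ _

/-- Bounds the length of queries: one step lengthens the possibly nonblank part to the right of the
head by at most one cell. -/
theorem run_blankFrom (t : ℕ) (x : List Bool) : BlankFrom (t + 1) ((M.run O t x).tape 1) := by
  induction t with
  | zero =>
    intro m hm
    have h1 : ((M.run O 0 x).tape 1).right₀ = ListBlank.mk [] := by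
      simp only [run, Function.iterate_zero, id, init]
      rw [if_neg (by simp), Tape.mk₁, Tape.mk₂, Tape.mk'_right₀]
    rw [h1, ListBlank.nth_mk]; rfl
  | succ t ih =>
    rw [run_succ]
    generalize M.run O t x = c at ih ⊢
    unfold step
    split
    · exact fun m hm => ih m (by omega)
    · exact fun m hm => ih m (by omega)
    · exact ih.tapeAct (by omega) _

/-- A run of `t` steps depends on at most `t` oracle bits, at words of length at most `t`. -/
theorem exists_queries (t : ℕ) (x : List Bool) :
    ∃ Q : Finset (List Bool), Q.card ≤ t ∧ (∀ u ∈ Q, u.length ≤ t) ∧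
      ∀ O' : Set (List Bool), (∀ u ∈ Q, u ∈ O' ↔ u ∈ O) → M.run O' t x = M.run O t x := by
  induction t with
  | zero => exact ⟨∅, by simp, by simp, fun _ _ => rfl⟩
  | succ t ih =>
    classical
    obtain ⟨Q, hQ, hlen, h⟩ := ih
    by_cases hw : ∃ w, Holds ((M.run O t x).tape 1) w
    · obtain ⟨w, hw⟩ := hw
      refine ⟨insert w Q, (Finset.card_insert_le _ _).trans (by omega), ?_, ?_⟩
      · intro u hu
        rcases Finset.mem_insert.1 hu with rfl | hu
        · exact hw.length_le (M.run_blankFrom O t x)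
        · exact (hlen u hu).trans (by omega)
      · intro O' hO'
        rw [run_succ, run_succ, h O' fun u hu => hO' u (Finset.mem_insert_of_mem hu)]
        have key : (∃ v ∈ O', Holds ((M.run O t x).tape 1) v) ↔
            ∃ v ∈ O, Holds ((M.run O t x).tape 1) v := by
          have hw' := hO' w (Finset.mem_insert_self _ _)
          constructor
          · rintro ⟨v, hv, hv'⟩
            obtain rfl := hw.unique hv'
            exact ⟨w, hw'.1 hv, hw⟩
          · rintro ⟨v, hv, hv'⟩
            obtain rfl := hw.unique hv'
            exact ⟨w, hw'.2 hv, hw⟩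
        unfold step
        simp only [key]
    · refine ⟨Q, by omega, fun u hu => (hlen u hu).trans (by omega), fun O' hO' => ?_⟩
      rw [run_succ, run_succ, h O' hO']
      push Not at hw
      unfold step
      simp [hw]

theorem run_congr {O O' : Set (List Bool)} {t : ℕ}
    (h : ∀ u : List Bool, u.length ≤ t → (u ∈ O' ↔ u ∈ O)) (x : List Bool) :
    M.run O' t x = M.run O t x := by
  obtain ⟨Q, -, hlen, hQ⟩ := M.exists_queries O t x
  exact hQ O' fun u hu => h u (hlen u hu)

/-- If each oracle bit at a word of length at most `t` is the same for all but `K` members of a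
family of oracles, then a run of `t` steps is the same for all but `t * K` members. -/
theorem run_stable {V : Type*} (F : V → Set (List Bool)) {t K : ℕ}
    (h : ∀ u : List Bool, u.length ≤ t →
      ∃ C : Finset V, C.card ≤ K ∧ ∀ v ∉ C, (u ∈ F v ↔ u ∈ O)) (x : List Bool) :
    ∃ C : Finset V, C.card ≤ t * K ∧ ∀ v ∉ C, M.run (F v) t x = M.run O t x := by
  classical
  obtain ⟨Q, hcard, hlen, hQ⟩ := M.exists_queries O t x
  have h' : ∀ u : List Bool, ∃ C : Finset V, u ∈ Q →
      C.card ≤ K ∧ ∀ v ∉ C, (u ∈ F v ↔ u ∈ O) := by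
    intro u
    by_cases hu : u ∈ Q
    · obtain ⟨C, hC⟩ := h u (hlen u hu)
      exact ⟨C, fun _ => hC⟩
    · exact ⟨∅, fun h => (hu h).elim⟩
  choose C hC using h'
  refine ⟨Q.biUnion C, ?_, ?_⟩
  · refine (Finset.card_biUnion_le_card_mul _ _ K fun u hu => (hC u hu).1).trans ?_
    exact Nat.mul_le_mul_right _ hcard
  · intro v hv
    refine hQ _ fun u hu => (hC u hu).2 v fun hv' => hv ?_
    exact Finset.mem_biUnion.2 ⟨u, hu, hv'⟩

theorem step_eq_self {c : M.Cfg} (h : M.instr c.state = .halt) : M.step O c = c := by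
  unfold step
  rw [h]

theorem run_eq_of_halt {t t' : ℕ} {x : List Bool} (htt' : t ≤ t')
    (h : M.instr (M.run O t x).state = .halt) : M.run O t' x = M.run O t x := by
  obtain ⟨d, rfl⟩ := Nat.exists_eq_add_of_le htt'
  induction d with
  | zero => rfl
  | succ d ih =>
    rw [← Nat.add_assoc, run_succ, ih (by omega)]
    exact M.step_eq_self O h

variable {M O}

theorem Outputs.mono {t t' : ℕ} {x y : List Bool} (h : M.Outputs O t x y) (htt' : t ≤ t') :
    M.Outputs O t' x y := by
  have := M.run_eq_of_halt O htt' h.1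
  unfold Outputs
  unfold run at this
  rw [this]
  exact h

theorem Outputs.unique {t : ℕ} {x y y' : List Bool} (h : M.Outputs O t x y)
    (h' : M.Outputs O t x y') : y = y' :=
  h.2.unique h'.2

variable (M O)

open Classical in
/-- The output after `t` steps on input `x`, or the empty word if there is none. -/
noncomputable def out (t : ℕ) (x : List Bool) : List Bool :=
  if h : ∃ y, M.Outputs O t x y then h.choose else []

variable {M O}

theorem Outputs.out_eq {t : ℕ} {x y : List Bool} (h : M.Outputs O t x y) : M.out O t x = y := by
  have h' : ∃ y, M.Outputs O t x y := ⟨y, h⟩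
  unfold out
  rw [dif_pos h']
  exact h'.choose_spec.unique h

theorem out_eq_of_run_eq {O' : Set (List Bool)} {t : ℕ} {x : List Bool}
    (h : M.run O' t x = M.run O t x) : M.out O' t x = M.out O t x := by
  have : M.Outputs O' t x = M.Outputs O t x := by
    funext y
    unfold Outputs
    unfold run at h
    rw [h]
  unfold out
  rw [this]

end OracleTM

theorem OracleTM.step_query {M : OracleTM} {O : Set (List Bool)} {c : M.Cfg}
    {yes no : Fin (M.maxState + 1)} (h : M.instr c.state = .query yes no) :
    ((∃ w ∈ O, Holds (c.tape 1) w) → M.step O c = ⟨yes, c.tape⟩) ∧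
    ((¬ ∃ w ∈ O, Holds (c.tape 1) w) → M.step O c = ⟨no, c.tape⟩) := by
  unfold OracleTM.step
  rw [h]
  exact ⟨fun h' => by simp only [if_pos h'], fun h' => by simp only [if_neg h']⟩

/-! ### A machine guided by its oracle -/

/-- The `i`-th query of the guided machine with index `c` on input `x`. -/
def code (c : ℕ) (x : List Bool) (i : ℕ) : List Bool :=
  List.replicate i false ++ (List.replicate c true ++ false :: x.flatMap fun b => [b, true])

/-- The answers that make the guided machine write the word `y` after `l` idle rounds. -/
def script (l : ℕ) (y : List Bool) : List Bool :=
  List.replicate l false ++ true :: (y.reverse.flatMap (fun b => [false, b]) ++ [true])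

namespace Guided

/-- Move both heads or write on both tapes, depending on the symbols under the heads, and continue
in state `q`. -/
def rw2 {s : ℕ} (f : Option Bool → Option Bool → ℕ × (Option Bool × Option Turing.Dir) ×
    (Option Bool × Option Turing.Dir)) : Instr 0 s :=
  .act fun h => (Fin.ofNat _ (f (h 0) (h 1)).1,
    fun i => if i = 0 then (f (h 0) (h 1)).2.1 else (f (h 0) (h 1)).2.2)

/-- The program: states `0` to `2` and `17` onwards write `code c x 0` on the query tape, states
`3` to `7` wait for the first positive answer, and states `8` to `16` write the output. -/
def program (c : ℕ) : ℕ → Instr 0 (18 + c)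
  | 0 => rw2 fun a b => if a = none then (1, (a, some .left), (b, none))
      else (0, (a, some .right), (b, none))
  | 1 => rw2 fun a b => if a = none then (17, (a, none), (b, none))
      else (2, (a, none), (some true, some .left))
  | 2 => rw2 fun a _ => (1, (none, some .left), (a, some .left))
  | 3 => .query (Fin.ofNat _ 6) (Fin.ofNat _ 4)
  | 4 => rw2 fun a b => (5, (a, none), (b, some .left))
  | 5 => rw2 fun a _ => (3, (a, none), (some false, none))
  | 6 => rw2 fun a b => (7, (a, none), (b, some .left))
  | 7 => rw2 fun a _ => (8, (a, none), (some false, none))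
  | 8 => .query (Fin.ofNat _ 15) (Fin.ofNat _ 9)
  | 9 => rw2 fun a b => (10, (a, none), (b, some .left))
  | 10 => rw2 fun a _ => (11, (a, none), (some false, none))
  | 11 => .query (Fin.ofNat _ 13) (Fin.ofNat _ 12)
  | 12 => rw2 fun a b => (14, (a, some .left), (b, some .left))
  | 13 => rw2 fun a b => (16, (a, some .left), (b, some .left))
  | 14 => rw2 fun _ _ => (8, (some false, none), (some false, none))
  | 15 => .halt
  | 16 => rw2 fun _ _ => (8, (some true, none), (some false, none))
  | 17 => rw2 fun a _ => (18, (a, none), (some false, some .left))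
  | k + 18 => rw2 fun a b => if k = c then (3, (a, none), (b, some .right))
      else (k + 19, (a, none), (some true, some .left))

/-- The guided machine with index `c`. -/
def machine (c : ℕ) : OracleTM where
  work := 0
  maxState := 18 + c
  instr q := program c q.val

/-- The configuration with the given state and tapes. -/
def conf (c q : ℕ) (T₀ T₁ : Tape (Option Bool)) : (machine c).Cfg where
  state := Fin.ofNat _ q
  tape i := if i = 0 then T₀ else T₁

/-- `n` steps lead from the first configuration to the second one. -/
def Leads (c : ℕ) (O : Set (List Bool)) (n : ℕ) (a b : (machine c).Cfg) : Prop :=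
  ((machine c).step O)^[n] a = b

variable {c : ℕ} {O : Set (List Bool)}

theorem Leads.trans {m n : ℕ} {a b d : (machine c).Cfg} (h : Leads c O m a b)
    (h' : Leads c O n b d) : Leads c O (m + n) a d := by
  unfold Leads at *
  rw [Nat.add_comm, Function.iterate_add_apply, h, h']

theorem instr_conf {q : ℕ} (hq : q ≤ 18 + c) (T₀ T₁ : Tape (Option Bool)) :
    (machine c).instr (conf c q T₀ T₁).state = program c q := by
  have : (Fin.ofNat (18 + c + 1) q).val = q := Nat.mod_eq_of_lt (by omega)
  exact congrArg (program c) this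

theorem leads_rw2 {q : ℕ} (hq : q ≤ 18 + c) {f} (hf : program c q = rw2 f)
    (T₀ T₁ : Tape (Option Bool)) :
    Leads c O 1 (conf c q T₀ T₁) (conf c (f T₀.head T₁.head).1
      (tapeAct T₀ (f T₀.head T₁.head).2.1) (tapeAct T₁ (f T₀.head T₁.head).2.2)) := by
  change (machine c).step O _ = _
  unfold OracleTM.step
  rw [instr_conf hq, hf]
  simp only [rw2, conf]
  congr 1
  funext i
  match i with
  | ⟨0, _⟩ => rfl
  | ⟨1, _⟩ => rfl

theorem leads_query_yes {q yes no : ℕ} (hq : q ≤ 18 + c)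
    (hf : program c q = .query (Fin.ofNat _ yes) (Fin.ofNat _ no))
    (T₀ : Tape (Option Bool)) {L : ListBlank (Option Bool)} {u : List Bool} (hu : u ∈ O) :
    Leads c O 1 (conf c q T₀ (Tape.mk' L (ListBlank.mk (u.map some))))
      (conf c yes T₀ (Tape.mk' L (ListBlank.mk (u.map some)))) :=
  (OracleTM.step_query ((instr_conf hq _ _).trans hf)).1 ⟨u, hu, holds_mk'.2 rfl⟩

theorem leads_query_no {q yes no : ℕ} (hq : q ≤ 18 + c)
    (hf : program c q = .query (Fin.ofNat _ yes) (Fin.ofNat _ no))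
    (T₀ : Tape (Option Bool)) {L : ListBlank (Option Bool)} {u : List Bool} (hu : u ∉ O) :
    Leads c O 1 (conf c q T₀ (Tape.mk' L (ListBlank.mk (u.map some))))
      (conf c no T₀ (Tape.mk' L (ListBlank.mk (u.map some)))) :=
  (OracleTM.step_query ((instr_conf hq _ _).trans hf)).2 (by
    rintro ⟨w, hw, hw'⟩
    exact hu (holds_mk'.1 hw' ▸ hw))

/-- The word `u`, with the head on its first letter. -/
def at0 (u : List Bool) : Tape (Option Bool) :=
  Tape.mk' (ListBlank.mk []) (ListBlank.mk (u.map some))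

/-- The word `u`, with the head on the blank in front of it. -/
def before (u : List Bool) : Tape (Option Bool) :=
  Tape.mk' (ListBlank.mk []) ((ListBlank.mk (u.map some)).cons none)

/-- The word `l.reverse`, with the head on its last letter. -/
def atEnd (l : List Bool) : Tape (Option Bool) :=
  (Tape.mk' (ListBlank.mk (l.map some)) (ListBlank.mk [])).move .left

theorem cons_none_nil : (ListBlank.mk ([] : List (Option Bool))).cons none = ListBlank.mk [] :=
  ListBlank.cons_head_tail (ListBlank.mk ([] : List (Option Bool)))

theorem before_nil : before [] = at0 [] := by
  simp only [before, at0, List.map_nil, cons_none_nil]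

theorem atEnd_nil : atEnd [] = at0 [] := by
  simp only [atEnd, at0, List.map_nil, Tape.move_left_mk', ListBlank.tail_mk, ListBlank.head_mk]
  exact congrArg _ cons_none_nil

theorem atEnd_cons (b : Bool) (l : List Bool) : atEnd (b :: l) =
    Tape.mk' (ListBlank.mk (l.map some)) ((ListBlank.mk []).cons (some b)) := by
  simp [atEnd]

theorem tapeAct_head (T : Tape (Option Bool)) : tapeAct T (T.head, none) = T :=
  Tape.write_self T

theorem tapeAct_at0_left (u : List Bool) :
    tapeAct (at0 u) ((at0 u).head, some .left) = before u := by
  simp only [tapeAct]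
  rw [show (at0 u).write (at0 u).head = at0 u from Tape.write_self _]
  simp only [at0, before, Tape.move_left_mk', ListBlank.tail_mk, ListBlank.head_mk]
  rfl

theorem tapeAct_before (u : List Bool) (b : Bool) :
    tapeAct (before u) (some b, none) = at0 (b :: u) := by
  simp only [tapeAct, before, at0, Tape.write_mk', ListBlank.tail_cons]
  rfl

theorem tapeAct_before_left (u : List Bool) (b : Bool) :
    tapeAct (before u) (some b, some .left) = before (b :: u) := by
  simp only [tapeAct, before, Tape.write_mk', ListBlank.tail_cons, Tape.move_left_mk',
    ListBlank.tail_mk, ListBlank.head_mk]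
  rfl

theorem tapeAct_before_right (u : List Bool) :
    tapeAct (before u) ((before u).head, some .right) = at0 u := by
  simp only [tapeAct]
  rw [show (before u).write (before u).head = before u from Tape.write_self _]
  simp only [at0, before, Tape.move_right_mk', ListBlank.tail_cons, ListBlank.head_cons,
    cons_none_nil]

theorem leads_prepend_false {q q' q'' : ℕ} (hq : q ≤ 18 + c) (hq' : q' ≤ 18 + c)
    (h : program c q = rw2 fun a b => (q', (a, none), (b, some .left)))
    (h' : program c q' = rw2 fun a _ => (q'', (a, none), (some false, none)))
    (T₀ : Tape (Option Bool)) (u : List Bool) :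
    Leads c O 2 (conf c q T₀ (at0 u)) (conf c q'' T₀ (at0 (false :: u))) := by
  have h1 := leads_rw2 (O := O) hq h T₀ (at0 u)
  have h2 := leads_rw2 (O := O) hq' h' T₀ (before u)
  simp only [tapeAct_head, tapeAct_at0_left, tapeAct_before] at h1 h2
  exact h1.trans h2

theorem leads_write {q q' : ℕ} {d : Bool} (hq : q ≤ 18 + c) (hq' : q' ≤ 18 + c)
    (h : program c q = rw2 fun a b => (q', (a, some .left), (b, some .left)))
    (h' : program c q' = rw2 fun _ _ => (8, (some d, none), (some false, none)))
    (y u : List Bool) :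
    Leads c O 2 (conf c q (at0 y) (at0 u)) (conf c 8 (at0 (d :: y)) (at0 (false :: u))) := by
  have h1 := leads_rw2 (O := O) hq h (at0 y) (at0 u)
  have h2 := leads_rw2 (O := O) hq' h' (before y) (before u)
  simp only [tapeAct_at0_left, tapeAct_before] at h1 h2
  exact h1.trans h2

/-- The input is copied from its end, because words on the query tape grow only to the left. -/
theorem leads_scan (T₁ : Tape (Option Bool)) (r l : List Bool) :
    Leads c O (r.length + 1)
      (conf c 0 (Tape.mk' (ListBlank.mk (l.map some)) (ListBlank.mk (r.map some))) T₁)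
      (conf c 1 (atEnd (r.reverse ++ l)) T₁) := by
  induction r generalizing l with
  | nil =>
    have h := leads_rw2 (O := O) (c := c) (q := 0) (by omega) (by rw [program])
      (Tape.mk' (ListBlank.mk (l.map some)) (ListBlank.mk [])) T₁
    have hd : (Tape.mk' (ListBlank.mk (l.map some)) (ListBlank.mk [])).head = none := rfl
    rw [if_pos hd] at h
    simp only [tapeAct_head] at h
    simp only [tapeAct] at h
    rw [Tape.write_self] at h
    exact h
  | cons b r ih =>
    have h := leads_rw2 (O := O) (c := c) (q := 0) (by omega) (by rw [program])
      (Tape.mk' (ListBlank.mk (l.map some)) (ListBlank.mk ((b :: r).map some))) T₁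
    have hd : (Tape.mk' (ListBlank.mk (l.map some)) (ListBlank.mk ((b :: r).map some))).head =
      some b := rfl
    rw [if_neg (by rw [hd]; simp)] at h
    simp only [tapeAct_head] at h
    simp only [tapeAct] at h
    rw [Tape.write_self] at h
    simp only [Tape.move_right_mk', List.map_cons, ListBlank.head_mk, ListBlank.tail_mk,
      ListBlank.cons_mk, List.headI_cons, List.tail_cons] at h
    have := h.trans (ih (b :: l))
    rw [List.length_cons, List.reverse_cons, List.append_assoc, Nat.add_comm]
    exact this

/-- Copying erases the input, which leaves tape `0` blank for the output. -/
theorem leads_copy (l u : List Bool) :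
    Leads c O (2 * l.length) (conf c 1 (atEnd l) (before u))
      (conf c 1 (at0 []) (before (l.reverse.flatMap (fun b => [b, true]) ++ u))) := by
  induction l generalizing u with
  | nil => rw [atEnd_nil]; exact rfl
  | cons b l ih =>
    have h := leads_rw2 (O := O) (c := c) (q := 1) (by omega) (by rw [program]) (atEnd (b :: l)) (before u)
    have hd : (atEnd (b :: l)).head = some b := by rw [atEnd_cons]; simp
    have h2 := leads_rw2 (O := O) (c := c) (q := 2) (by omega) (by rw [program]) (atEnd (b :: l))
      (before (true :: u))
    rw [if_neg (by rw [hd]; simp)] at h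
    simp only [tapeAct_head, tapeAct_before_left] at h
    simp only [hd, tapeAct_before_left] at h2
    have he : tapeAct (atEnd (b :: l)) (none, some .left) = atEnd l := by
      rw [atEnd_cons]
      simp only [tapeAct, Tape.write_mk', ListBlank.tail_cons, cons_none_nil]
      rfl
    rw [he] at h2
    have := (h.trans h2).trans (ih (b :: true :: u))
    rw [List.length_cons, List.reverse_cons, List.flatMap_append, List.append_assoc]
    rw [show 2 * (l.length + 1) = 1 + 1 + 2 * l.length by omega]
    exact this

theorem leads_index (k : ℕ) (T₀ : Tape (Option Bool)) (u : List Bool) {j : ℕ} (hj : j + k = c) :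
    Leads c O (k + 1) (conf c (j + 18) T₀ (before u))
      (conf c 3 T₀ (at0 (List.replicate k true ++ u))) := by
  induction k generalizing j u with
  | zero =>
    have h := leads_rw2 (O := O) (c := c) (q := j + 18) (by omega) (by rw [program]) T₀ (before u)
    rw [if_pos (by omega)] at h
    simp only [tapeAct_head, tapeAct_before_right] at h
    exact h
  | succ k ih =>
    have h := leads_rw2 (O := O) (c := c) (q := j + 18) (by omega) (by rw [program]) T₀ (before u)
    rw [if_neg (by omega)] at h
    simp only [tapeAct_head, tapeAct_before_left] at h
    have := h.trans (ih (true :: u) (j := j + 1) (by omega))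
    rw [Nat.add_comm, List.replicate_succ']
    simpa using this

/-- The index `i` is written in unary at the front so that the next query costs one letter. -/
theorem code_succ (x : List Bool) (i : ℕ) : code c x (i + 1) = false :: code c x i := by
  simp [code, List.replicate_succ]

theorem leads_setup (x : List Bool) :
    Leads c O (3 * x.length + c + 4) ((machine c).init x)
      (conf c 3 (at0 []) (at0 (code c x 0))) := by
  have h0 : (machine c).init x = conf c 0 (Tape.mk' (ListBlank.mk (([] : List Bool).map some))
      (ListBlank.mk (x.map some))) (before []) := by
    rw [before_nil]
    rfl
  have h1 := leads_scan (c := c) (O := O) (before []) x []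
  rw [List.append_nil] at h1
  have h2 := leads_copy (c := c) (O := O) x.reverse []
  rw [List.reverse_reverse, List.append_nil] at h2
  have h3 := leads_rw2 (O := O) (c := c) (q := 1) (by omega) (by rw [program]) (at0 [])
    (before (x.flatMap fun b => [b, true]))
  rw [if_pos (show (at0 []).head = none from rfl)] at h3
  simp only [tapeAct_head] at h3
  have h4 := leads_rw2 (O := O) (c := c) (q := 17) (by omega) (by rw [program]) (at0 [])
    (before (x.flatMap fun b => [b, true]))
  simp only [tapeAct_head, tapeAct_before_left] at h4
  have h5 := leads_index (O := O) c (at0 []) (false :: x.flatMap fun b => [b, true]) (j := 0)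
    (Nat.zero_add c)
  rw [h0]
  have := (((h1.trans h2).trans h3).trans h4).trans h5
  rw [List.length_reverse, show x.length + 1 + 2 * x.length + 1 + 1 + (c + 1) =
    3 * x.length + c + 4 by omega] at this
  simpa [code] using this

theorem leads_idle (T₀ : Tape (Option Bool)) (x : List Bool) {l : ℕ}
    (h : ∀ i < l, code c x i ∉ O) (hl : code c x l ∈ O) :
    Leads c O (3 * l + 3) (conf c 3 T₀ (at0 (code c x 0)))
      (conf c 8 T₀ (at0 (code c x (l + 1)))) := by
  have key : ∀ i ≤ l, Leads c O (3 * i) (conf c 3 T₀ (at0 (code c x 0)))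
      (conf c 3 T₀ (at0 (code c x i))) := by
    intro i
    induction i with
    | zero => exact fun _ => rfl
    | succ i ih =>
      intro hi
      have h2 := leads_query_no (O := O) (c := c) (q := 3) (by omega) rfl T₀
        (L := ListBlank.mk []) (h i (by omega))
      have h3 := leads_prepend_false (O := O) (c := c) (q := 4) (q' := 5) (by omega) (by omega)
        rfl rfl T₀ (code c x i)
      rw [code_succ]
      exact ((ih (by omega)).trans h2).trans h3
  have h2 := leads_query_yes (O := O) (c := c) (q := 3) (by omega) rfl T₀
    (L := ListBlank.mk []) hl
  have h3 := leads_prepend_false (O := O) (c := c) (q := 6) (q' := 7) (by omega) (by omega)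
    rfl rfl T₀ (code c x l)
  rw [code_succ]
  exact ((key l le_rfl).trans h2).trans h3

/-- Each round reads a flag and, if the flag is negative, an output bit; a positive flag means stop.
Bits are prepended to the output, so `z` is read in reverse order. -/
theorem leads_output (x : List Bool) (z y : List Bool) {i : ℕ}
    (h : ∀ j, code c x (i + j) ∈ O ↔
      (z.flatMap (fun b => [false, b]) ++ [true])[j]?.getD false = true) :
    ∃ u, Leads c O (6 * z.length + 1) (conf c 8 (at0 y) (at0 (code c x i)))
      (conf c 15 (at0 (z.reverse ++ y)) u) := by
  induction z generalizing y i with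
  | nil =>
    exact ⟨_, leads_query_yes (O := O) (c := c) (q := 8) (by omega) rfl (at0 y)
      (L := ListBlank.mk []) ((h 0).2 rfl)⟩
  | cons b z ih =>
    have h0 : code c x i ∉ O := fun h' => by simpa using (h 0).1 h'
    have h1 : code c x (i + 1) ∈ O ↔ b = true := by simpa using h 1
    obtain ⟨u, hu⟩ := ih (b :: y) (i := i + 2) fun j => by
      rw [Nat.add_assoc, h (2 + j), Nat.add_comm 2 j]
      simp
    refine ⟨u, ?_⟩
    have h2 := leads_query_no (O := O) (c := c) (q := 8) (by omega) rfl (at0 y)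
      (L := ListBlank.mk []) h0
    have h3 := leads_prepend_false (O := O) (c := c) (q := 9) (q' := 10) (by omega) (by omega)
      rfl rfl (at0 y) (code c x i)
    rw [← code_succ] at h3
    have h4 : Leads c O 3 (conf c 11 (at0 y) (at0 (code c x (i + 1))))
        (conf c 8 (at0 (b :: y)) (at0 (code c x (i + 2)))) := by
      rw [code_succ x (i + 1)]
      cases b
      · have h5 := leads_query_no (O := O) (c := c) (q := 11) (by omega) rfl (at0 y)
          (L := ListBlank.mk []) (u := code c x (i + 1)) (by simp [h1])
        exact h5.trans (leads_write (q := 12) (q' := 14) (by omega) (by omega) rfl rfl _ _)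
      · have h5 := leads_query_yes (O := O) (c := c) (q := 11) (by omega) rfl (at0 y)
          (L := ListBlank.mk []) (u := code c x (i + 1)) (by simp [h1])
        exact h5.trans (leads_write (q := 13) (q' := 16) (by omega) (by omega) rfl rfl _ _)
    have := ((h2.trans h3).trans h4).trans hu
    rw [List.length_cons, show 6 * (z.length + 1) + 1 = 1 + 2 + 3 + (6 * z.length + 1) by omega,
      List.reverse_cons, List.append_assoc]
    exact this

end Guided

/-- A function of polynomial growth is in `FP O` if the oracle answers the queries of a guided
machine according to its values. -/
theorem mem_FP_of_script {O : Set (List Bool)} {F : List Bool → List Bool} (c : ℕ)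
    (l b : Polynomial ℕ) (hF : ∀ x, (F x).length ≤ b.eval x.length)
    (h : ∀ x i, code c x i ∈ O ↔ (script (l.eval x.length) (F x))[i]?.getD false = true) :
    F ∈ FP O := by
  refine ⟨Guided.machine c, 3 * Polynomial.X + 3 * l + 6 * b + Polynomial.C (c + 8), fun x => ?_⟩
  set n := l.eval x.length with hn
  have h1 := Guided.leads_setup (c := c) (O := O) x
  have h2 := Guided.leads_idle (c := c) (O := O) (Guided.at0 []) x (l := n)
    (fun i hi => by
      rw [h, script, List.getElem?_append_left (by simpa using hi)]
      simp [← hn, hi])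
    (by
      rw [h, script, List.getElem?_append_right (by simp [hn])]
      simp [hn])
  obtain ⟨u, h3⟩ := Guided.leads_output (c := c) (O := O) x (F x).reverse [] (i := n + 1)
    (fun j => by
      rw [h, script, List.getElem?_append_right (by simp [← hn]; omega)]
      simp only [List.length_replicate, ← hn]
      rw [show n + 1 + j - n = j + 1 by omega, List.getElem?_cons_succ])
  have h4 := (h1.trans h2).trans h3
  have h5 : (Guided.machine c).Outputs O
      (3 * x.length + c + 4 + (3 * n + 3) + (6 * (F x).reverse.length + 1)) x (F x) := by
    unfold OracleTM.Outputs
    unfold Guided.Leads at h4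
    rw [h4]
    refine ⟨?_, ?_⟩
    · rw [Guided.instr_conf (by omega)]
      rfl
    · change Holds (Guided.at0 _) _
      rw [List.reverse_reverse, List.append_nil]
      exact holds_mk'.2 rfl
  refine h5.mono ?_
  have := hF x
  simp only [List.length_reverse, Polynomial.eval_add, Polynomial.eval_mul, Polynomial.eval_X,
    Polynomial.eval_C, Polynomial.eval_ofNat, ← hn]
  omega

/-! ### Codes and scripts -/

theorem flatMap_append_false_injective {l l' r r' : List Bool}
    (h : l.flatMap (fun b => [true, b]) ++ false :: r =
      l'.flatMap (fun b => [true, b]) ++ false :: r') : l = l' ∧ r = r' := by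
  induction l generalizing l' with
  | nil => cases l' <;> simp_all
  | cons b l ih =>
    cases l' with
    | nil => simp at h
    | cons b' l' =>
      simp only [List.flatMap_cons, List.cons_append, List.cons.injEq, List.nil_append,
        true_and] at h
      obtain ⟨rfl, h⟩ := h
      obtain ⟨rfl, rfl⟩ := ih h
      exact ⟨rfl, rfl⟩

theorem code_length (c : ℕ) (x : List Bool) (i : ℕ) :
    (code c x i).length = i + c + 2 * x.length + 1 := by
  simp [code]
  ring

/-- Read from the right, a code consists of blocks `true, b` up to the first `false` in block
position; the letters `true` that remain number `c` and the other ones number `i`. -/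
theorem code_injective {c c' i i' : ℕ} {x x' : List Bool} (h : code c x i = code c' x' i') :
    c = c' ∧ x = x' ∧ i = i' := by
  have hrev : ∀ y : List Bool, (y.flatMap fun b => [b, true]).reverse =
      y.reverse.flatMap fun b => [true, b] := by
    intro y; rw [List.reverse_flatMap]; rfl
  have h' := congrArg List.reverse h
  simp only [code, List.reverse_append, List.reverse_cons, List.append_assoc, hrev,
    List.reverse_replicate, List.cons_append, List.nil_append] at h'
  obtain ⟨hx, hr⟩ := flatMap_append_false_injective h'
  have h1 := congrArg (List.count true) hr
  have h2 := congrArg List.length hr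
  simp [List.count_replicate] at h1 h2
  exact ⟨h1, List.reverse_injective hx, by omega⟩

/-- Answers up to the end of the idle rounds do not depend on the value to be written. This makes
the recursive definition of the oracle consistent. -/
theorem script_of_le {l i : ℕ} (hi : i ≤ l) (y y' : List Bool) :
    (script l y)[i]? = (script l y')[i]? := by
  rcases hi.lt_or_eq with hi | rfl
  · simp only [script]
    rw [List.getElem?_append_left (by simpa using hi),
      List.getElem?_append_left (by simpa using hi)]
  · simp [script]

/-! ### The hidden data and the equivalence relations defined by them -/

/-- Two sets of words, on which the oracles depend. -/
abbrev Hidden := Bool → Set (List Bool)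

/-- The part of the hidden data below length `m`. -/
def trunc (m : ℕ) (A : Hidden) : Hidden := fun f => {w | w ∈ A f ∧ w.length < m}

/-- Words of the same length that both belong to `A f` are equivalent. -/
def hiddenRel (A : Hidden) (f : Bool) : Setoid (List Bool) where
  r x y := x = y ∨ x.length = y.length ∧ x ∈ A f ∧ y ∈ A f
  iseqv :=
    { refl := fun _ => Or.inl rfl
      symm := by
        rintro x y (rfl | ⟨h, hx, hy⟩)
        · exact Or.inl rfl
        · exact Or.inr ⟨h.symm, hy, hx⟩
      trans := by
        rintro x y z (rfl | ⟨h, hx, hy⟩) (rfl | ⟨h', hy', hz⟩)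
        · exact Or.inl rfl
        · exact Or.inr ⟨h', hy', hz⟩
        · exact Or.inr ⟨h, hx, hy⟩
        · exact Or.inr ⟨h.trans h', hx, hz⟩ }

theorem hiddenRel_iff {A : Hidden} {f : Bool} {x y : List Bool} :
    hiddenRel A f x y ↔ x = y ∨ x.length = y.length ∧ x ∈ A f ∧ y ∈ A f := Iff.rfl

/-- An injective numbering of words in which longer words come later. -/
def rank : List Bool → ℕ
  | [] => 1
  | b :: w => 2 * rank w + b.toNat

theorem rank_bounds (w : List Bool) : 2 ^ w.length ≤ rank w ∧ rank w < 2 ^ (w.length + 1) := by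
  induction w with
  | nil => simp [rank]
  | cons b w ih =>
    have := b.toNat_le
    simp only [rank, List.length_cons]
    omega

theorem length_le_of_rank_le {w v : List Bool} (h : rank w ≤ rank v) : w.length ≤ v.length := by
  have := (rank_bounds w).1.trans_lt (h.trans_lt (rank_bounds v).2)
  have := (Nat.pow_lt_pow_iff_right (by norm_num)).1 this
  omega

theorem rank_injective : Function.Injective rank := by
  intro w v h
  have hl : w.length = v.length :=
    le_antisymm (length_le_of_rank_le h.le) (length_le_of_rank_le h.ge)
  induction w generalizing v with
  | nil => exact (List.length_eq_zero_iff.1 hl.symm).symm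
  | cons b w ih =>
    cases v with
    | nil => simp at hl
    | cons b' v =>
      simp only [rank] at h
      have h1 := b.toNat_le
      have h2 := b'.toNat_le
      have hwv : w = v := ih (by omega) (by simpa using hl)
      have hb : b.toNat = b'.toNat := by omega
      rw [hwv]
      cases b <;> cases b' <;> simp_all

theorem exists_minimal_rank {S : Set (List Bool)} (hS : S.Nonempty) :
    ∃ y ∈ S, ∀ y' ∈ S, rank y ≤ rank y' :=
  ⟨Function.argminOn rank S hS, Function.argminOn_mem _ _ _,
    fun _ hy => Function.argminOn_le rank S hy⟩

theorem eval_mono (p : Polynomial ℕ) {m n : ℕ} (h : m ≤ n) : p.eval m ≤ p.eval n := by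
  rw [Polynomial.eval_eq_sum, Polynomial.eval_eq_sum]
  exact Finset.sum_le_sum fun i _ => Nat.mul_le_mul_left _ (Nat.pow_le_pow_left h i)

/-! ### Canonical elements -/

section Canon

variable (M : OracleTM) (p : Polynomial ℕ) (P : Hidden → Set (List Bool)) (A : Hidden)
  (x : List Bool)

/-- The words of length at most `p |x| + |x|` at which `M` has, with the oracle for the hidden data
below `m`, the output that it has at `x` with the full oracle. -/
def candidates (m : ℕ) : Set (List Bool) :=
  {y | y.length ≤ p.eval x.length + x.length ∧
    M.out (P (trunc m A)) (p.eval y.length) y = M.out (P A) (p.eval x.length) x}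

/-- `y` is the first candidate at `m`, and it has the same output as `x` with the full oracle. -/
def Admissible (m : ℕ) (y : List Bool) : Prop :=
  (y ∈ candidates M p P A x m ∧ ∀ y' ∈ candidates M p P A x m, rank y ≤ rank y') ∧
    M.out (P A) (p.eval y.length) y = M.out (P A) (p.eval x.length) x

/-- `y` is admissible at the least possible `m`. -/
def IsCanonical (y : List Bool) : Prop :=
  ∃ m, Admissible M p P A x m y ∧ ∀ m' < m, ∀ y', ¬ Admissible M p P A x m' y'

open Classical in
/-- The canonical word with the same output as `x`, or the empty word if there is none. -/
noncomputable def canon : List Bool :=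
  if h : ∃ y, IsCanonical M p P A x y then h.choose else []

variable {M p P A x}

theorem IsCanonical.unique {y y' : List Bool} (h : IsCanonical M p P A x y)
    (h' : IsCanonical M p P A x y') : y = y' := by
  obtain ⟨m, hm, hlt⟩ := h
  obtain ⟨m', hm', hlt'⟩ := h'
  rcases lt_trichotomy m m' with hmm | rfl | hmm
  · exact (hlt' m hmm y hm).elim
  · exact rank_injective (le_antisymm (hm.1.2 y' hm'.1.1) (hm'.1.2 y hm.1.1))
  · exact (hlt m' hmm y' hm').elim

theorem IsCanonical.canon_eq {y : List Bool} (h : IsCanonical M p P A x y) :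
    canon M p P A x = y := by
  have h' : ∃ y, IsCanonical M p P A x y := ⟨y, h⟩
  unfold canon
  rw [dif_pos h']
  exact h'.choose_spec.unique h

theorem exists_isCanonical (h : ∃ m y, Admissible M p P A x m y) :
    ∃ y, IsCanonical M p P A x y := by
  classical
  obtain ⟨y, hy⟩ := Nat.find_spec h
  exact ⟨y, Nat.find h, hy, fun m' hm' y' hy' => Nat.find_min h hm' ⟨y', hy'⟩⟩

theorem canon_length_le : (canon M p P A x).length ≤ p.eval x.length + x.length := by
  by_cases h : ∃ y, IsCanonical M p P A x y
  · obtain ⟨y, hy⟩ := h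
    rw [hy.canon_eq]
    obtain ⟨m, hm, -⟩ := hy
    exact hm.1.1.1
  · unfold canon
    rw [dif_neg h]
    simp

/-- A bound for the running times of the computations that define `canon`. -/
noncomputable def runBound (p : Polynomial ℕ) : Polynomial ℕ :=
  p.comp (p + Polynomial.X) + 1

theorem eval_le_runBound (p : Polynomial ℕ) {m n : ℕ} (h : m ≤ p.eval n + n) :
    p.eval m ≤ (runBound p).eval n := by
  have := eval_mono p h
  simp only [runBound, Polynomial.eval_add, Polynomial.eval_comp, Polynomial.eval_X,
    Polynomial.eval_one]
  omega

/-- All runs entering the definition have inputs of length at most `p |x| + |x|`, so their queries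
have length at most `runBound p` at `|x|`. -/
theorem canon_congr {P' : Hidden → Set (List Bool)} {A' : Hidden}
    (h : ∀ v : List Bool, v.length ≤ (runBound p).eval x.length → (v ∈ P' A' ↔ v ∈ P A))
    (hm : ∀ m, ∀ v : List Bool, v.length ≤ (runBound p).eval x.length →
      (v ∈ P' (trunc m A') ↔ v ∈ P (trunc m A))) :
    canon M p P' A' x = canon M p P A x := by
  have h1 : ∀ y : List Bool, y.length ≤ p.eval x.length + x.length →
      M.out (P' A') (p.eval y.length) y = M.out (P A) (p.eval y.length) y := fun y hy =>
    OracleTM.out_eq_of_run_eq (M.run_congr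
      (fun v hv => h v (hv.trans (eval_le_runBound p hy))) y)
  have h2 : ∀ m, ∀ y : List Bool, y.length ≤ p.eval x.length + x.length →
      M.out (P' (trunc m A')) (p.eval y.length) y =
        M.out (P (trunc m A)) (p.eval y.length) y := fun m y hy =>
    OracleTM.out_eq_of_run_eq (M.run_congr
      (fun v hv => hm m v (hv.trans (eval_le_runBound p hy))) y)
  have h3 : candidates M p P' A' x = candidates M p P A x := by
    funext m
    ext y
    simp only [candidates, Set.mem_ofPred_eq]
    refine and_congr_right fun hy => ?_
    rw [h2 m y hy, h1 x (by omega)]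
  have h4 : Admissible M p P' A' x = Admissible M p P A x := by
    funext m y
    simp only [Admissible, h3]
    refine propext (and_congr_right fun hy => ?_)
    rw [h1 y hy.1.1, h1 x (by omega)]
  unfold canon IsCanonical
  rw [h4]

end Canon

/-! ### The oracles -/

section Oracle

variable (mach : ℕ → Option (OracleTM × Polynomial ℕ))

open Classical in
/-- The functions that the oracle helps to compute: function `0` decides `hiddenRel A false`,
function `1` is a complete invariant for `hiddenRel A true`, and the other ones compute canonical
words for the machines in the list `mach`. -/
noncomputable def task (P : Hidden → Set (List Bool)) (A : Hidden) (x : List Bool) :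
    ℕ → List Bool
  | 0 => if ∃ y z, x = pair y z ∧ hiddenRel A false y z then [true] else [false]
  | 1 => if x ∈ A true then true :: List.replicate x.length false else false :: x
  | c + 2 => (mach c).elim [] fun Mp => canon Mp.1 Mp.2 P A x

/-- The number of idle rounds, which keep the queries long enough. -/
noncomputable def delay : ℕ → Polynomial ℕ
  | 0 => 0
  | 1 => 0
  | c + 2 => (mach c).elim 0 fun Mp => 3 * runBound Mp.2 * (runBound Mp.2 ^ 2 + 2)

/-- The answer to the query `u`, in terms of the oracles `P`. -/
def Answer (P : Hidden → Set (List Bool)) (A : Hidden) (u : List Bool) : Prop :=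
  ∃ c x i, u = code c x i ∧
    (script ((delay mach c).eval x.length) (task mach P A x c))[i]?.getD false = true

/-- The oracle answers, by recursion on the length of the query. -/
def answers (u : List Bool) : Hidden → Prop := fun A =>
  Answer mach (fun B => {v | ∃ _ : v.length < u.length, answers v B}) A u
termination_by u.length

/-- The oracle for the hidden data `A`. -/
def oracle (A : Hidden) : Set (List Bool) := {u | answers mach u A}

variable {mach}

theorem answer_code {P : Hidden → Set (List Bool)} {A : Hidden} {c i : ℕ} {x : List Bool} :
    Answer mach P A (code c x i) ↔
      (script ((delay mach c).eval x.length) (task mach P A x c))[i]?.getD false = true := by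
  refine ⟨?_, fun h => ⟨c, x, i, rfl, h⟩⟩
  rintro ⟨c', x', i', h, h'⟩
  obtain ⟨rfl, rfl, rfl⟩ := code_injective h
  exact h'

theorem mem_oracle_iff {A : Hidden} {u : List Bool} : u ∈ oracle mach A ↔
    Answer mach (fun B => {v | v ∈ oracle mach B ∧ v.length < u.length}) A u := by
  change answers mach u A ↔ _
  rw [answers]
  simp only [exists_prop, oracle, Set.mem_ofPred_eq, and_comm]

/-- With `s` the run bound, the delay exceeds `s` enough for the recursion; the factor `s ^ 2 + 2`
serves the count of exceptional pairs in `oracle_addPair_false`. -/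
theorem runBound_lt_of_delay_lt {c i : ℕ} {M : OracleTM} {p : Polynomial ℕ}
    (hc : mach c = some (M, p)) {x : List Bool} (hi : (delay mach (c + 2)).eval x.length < i) :
    3 * (runBound p).eval x.length * ((runBound p).eval x.length ^ 2 + 2) <
      (code (c + 2) x i).length := by
  simp only [delay, hc, Option.elim_some, Polynomial.eval_mul, Polynomial.eval_add,
    Polynomial.eval_pow, Polynomial.eval_ofNat] at hi
  rw [code_length]
  omega

theorem le_delay_aux (s : ℕ) : s ≤ 3 * s * (s ^ 2 + 2) := by
  nlinarith [Nat.zero_le (s * s ^ 2)]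

/-- The oracle satisfies its defining recursion without restriction of the length. -/
theorem code_mem_oracle {A : Hidden} {c i : ℕ} {x : List Bool} : code c x i ∈ oracle mach A ↔
    (script ((delay mach c).eval x.length) (task mach (oracle mach) A x c))[i]?.getD false =
      true := by
  rw [mem_oracle_iff, answer_code]
  by_cases hi : i ≤ (delay mach c).eval x.length
  · rw [script_of_le hi]
  · suffices h : task mach (fun B => {v | v ∈ oracle mach B ∧
        v.length < (code c x i).length}) A x c = task mach (oracle mach) A x c by rw [h]
    match c with
    | 0 => rfl
    | 1 => rfl
    | c + 2 =>
      simp only [task]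
      match hc : mach c with
      | none => rfl
      | some (M, p) =>
        have h1 := runBound_lt_of_delay_lt hc (not_le.1 hi)
        have h2 := le_delay_aux ((runBound p).eval x.length)
        simp only [Option.elim_some]
        refine canon_congr ?_ ?_
        · intro v hv
          exact and_iff_left (by omega)
        · intro m v hv
          exact and_iff_left (by omega)

theorem exists_code_of_mem_oracle {A : Hidden} {u : List Bool} (h : u ∈ oracle mach A) :
    ∃ c x i, u = code c x i := by
  obtain ⟨c, x, i, h, -⟩ := mem_oracle_iff.1 h
  exact ⟨c, x, i, h⟩

theorem pair_injective {x y x' y' : List Bool} (h : pair x y = pair x' y') :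
    x = x' ∧ y = y' := by
  unfold pair at h
  induction x generalizing x' with
  | nil =>
    cases x' with
    | nil => simpa using h
    | cons b x' => cases b <;> simp at h
  | cons a x ih =>
    cases x' with
    | nil => cases a <;> simp at h
    | cons b x' =>
      simp only [List.flatMap_cons, List.cons_append, List.cons.injEq, List.nil_append] at h
      obtain ⟨rfl, -, h⟩ := h
      obtain ⟨rfl, rfl⟩ := ih h
      exact ⟨rfl, rfl⟩

theorem task_zero_pair {P : Hidden → Set (List Bool)} {A : Hidden} {y z : List Bool}
    [Decidable (hiddenRel A false y z)] : task mach P A (pair y z) 0 =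
      if hiddenRel A false y z then [true] else [false] := by
  have : (∃ y' z', pair y z = pair y' z' ∧ hiddenRel A false y' z') ↔ hiddenRel A false y z := by
    constructor
    · rintro ⟨y', z', h, h'⟩
      obtain ⟨rfl, rfl⟩ := pair_injective h
      exact h'
    · exact fun h => ⟨y, z, rfl, h⟩
  simp only [task, this]

theorem pair_length (x y : List Bool) : (pair x y).length = 2 * x.length + y.length + 2 := by
  simp [pair]
  ring

/-- The oracle bits at words of length at most `T` depend only on the hidden data below `T`. -/
theorem oracle_congr {T : ℕ} {A A' : Hidden}
    (h : ∀ f, ∀ w : List Bool, w.length < T → (w ∈ A' f ↔ w ∈ A f)) {u : List Bool}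
    (hu : u.length ≤ T) : u ∈ oracle mach A' ↔ u ∈ oracle mach A := by
  induction hn : u.length using Nat.strong_induction_on generalizing u A A' with
  | _ n ih =>
  subst hn
  by_cases hcode : ∃ c x i, u = code c x i
  swap
  · exact ⟨fun h' => (hcode (exists_code_of_mem_oracle h')).elim,
      fun h' => (hcode (exists_code_of_mem_oracle h')).elim⟩
  obtain ⟨c, x, i, rfl⟩ := hcode
  rw [code_mem_oracle, code_mem_oracle]
  by_cases hi : i ≤ (delay mach c).eval x.length
  · rw [script_of_le hi]
  suffices h : task mach (oracle mach) A' x c = task mach (oracle mach) A x c by rw [h]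
  rw [code_length] at hu
  match c with
  | 0 =>
    have : ∀ y z, (x = pair y z ∧ hiddenRel A' false y z) ↔
        (x = pair y z ∧ hiddenRel A false y z) := by
      intro y z
      refine and_congr_right fun hx => ?_
      -- `pair y z` is longer than `y` and `z`, so the query sees only words shorter than itself.
      have := congrArg List.length hx
      rw [pair_length] at this
      rw [hiddenRel_iff, hiddenRel_iff, h false y (by omega), h false z (by omega)]
    classical
    exact if_congr (exists_congr fun y => exists_congr (this y)) rfl rfl
  | 1 =>
    classical
    exact if_congr (h true x (by omega)) rfl rfl
  | c + 2 =>
    simp only [task]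
    match hc : mach c with
    | none => rfl
    | some (M, p) =>
      have h1 := runBound_lt_of_delay_lt hc (not_le.1 hi)
      have h2 := le_delay_aux ((runBound p).eval x.length)
      simp only [Option.elim_some]
      rw [code_length] at h1
      refine canon_congr ?_ ?_
      · intro v hv
        exact ih v.length (by rw [code_length]; omega) h (by omega) rfl
      · intro m v hv
        refine ih v.length (by rw [code_length]; omega) ?_ (by omega) rfl
        intro f w hw
        exact and_congr_left fun _ => h f w hw

/-! ### Functions and relations made easy by the oracle -/

variable (mach)

theorem exists_task_length_le (c : ℕ) : ∃ b : Polynomial ℕ, ∀ P A x,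
    (task mach P A x c).length ≤ b.eval x.length := by
  match c with
  | 0 =>
    refine ⟨1, fun P A x => ?_⟩
    simp only [task]
    split <;> simp
  | 1 =>
    refine ⟨Polynomial.X + 1, fun P A x => ?_⟩
    simp only [task]
    split <;> simp
  | c + 2 =>
    match hc : mach c with
    | none => exact ⟨0, fun P A x => by simp [task, hc]⟩
    | some (M, p) =>
      refine ⟨p + Polynomial.X, fun P A x => ?_⟩
      simp only [task, hc, Option.elim_some, Polynomial.eval_add, Polynomial.eval_X]
      exact canon_length_le

theorem task_mem_FP (A : Hidden) (c : ℕ) :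
    (fun x => task mach (oracle mach) A x c) ∈ FP (oracle mach A) := by
  obtain ⟨b, hb⟩ := exists_task_length_le mach c
  exact mem_FP_of_script c (delay mach c) b (fun x => hb _ _ x) fun x i => code_mem_oracle

theorem hiddenRel_false_mem_PEq (A : Hidden) : hiddenRel A false ∈ PEq (oracle mach A) := by
  classical
  obtain ⟨M, p, hM⟩ := task_mem_FP mach A 0
  refine ⟨M, p, fun x y => ?_⟩
  have := hM (pair x y)
  simp only [task_zero_pair] at this
  constructor
  · intro h
    rwa [if_pos h] at this
  · intro h
    rwa [if_neg h] at this

/-- The nontrivial class of a given length is named by that length alone, so the invariant reveals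
none of its members. -/
theorem hiddenRel_true_mem_Ker (A : Hidden) : hiddenRel A true ∈ Ker (oracle mach A) := by
  refine ⟨_, task_mem_FP mach A 1, fun x y => ?_⟩
  simp only [task, hiddenRel_iff]
  constructor
  · rintro (rfl | ⟨h, hx, hy⟩)
    · rfl
    · rw [if_pos hx, if_pos hy, h]
  · intro h
    split_ifs at h with hx hy
    · exact Or.inr ⟨by simpa using congrArg List.length h, hx, hy⟩
    · simp at h
    · simp at h
    · exact Or.inl (by simpa using h)

variable {mach}

theorem trunc_agree {A : Hidden} {m : ℕ} (f : Bool) (w : List Bool) (hw : w.length < m) :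
    w ∈ trunc m A f ↔ w ∈ A f :=
  and_iff_left hw

/-- If a machine in the list computes a complete invariant of a relation that is bounded by its
time bound, then the relation has a canonical form. -/
theorem mem_CF_of_mach {A : Hidden} {c : ℕ} {M : OracleTM} {p : Polynomial ℕ}
    (hc : mach c = some (M, p)) {R : Setoid (List Bool)} {f : List Bool → List Bool}
    (hf : ∀ x, M.Outputs (oracle mach A) (p.eval x.length) x (f x))
    (hR : IsCompleteInvariant R f) (hp : ∀ x y, R x y → x.length ≤ p.eval y.length) :
    R ∈ CF (oracle mach A) := by
  have hout : ∀ x, M.out (oracle mach A) (p.eval x.length) x = f x := fun x => (hf x).out_eq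
  have htask : ∀ x, task mach (oracle mach) A x (c + 2) = canon M p (oracle mach) A x := by
    intro x
    simp only [task, hc, Option.elim_some]
  have hex : ∀ x, ∃ y, IsCanonical M p (oracle mach) A x y := by
    intro x
    apply exists_isCanonical
    -- At this `m` the truncation no longer affects any relevant run, so `x` is a candidate and the
    -- first candidate passes the check.
    have hx : x ∈ candidates M p (oracle mach) A x ((runBound p).eval x.length) := by
      refine ⟨by omega, OracleTM.out_eq_of_run_eq (M.run_congr (fun v hv => ?_) x)⟩
      exact oracle_congr trunc_agree (hv.trans (eval_le_runBound p (by omega)))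
    obtain ⟨y, hy, hmin⟩ := exists_minimal_rank ⟨x, hx⟩
    refine ⟨(runBound p).eval x.length, y, ⟨hy, hmin⟩, ?_⟩
    rw [← hy.2]
    refine OracleTM.out_eq_of_run_eq (M.run_congr (fun v hv => ?_) y)
    exact (oracle_congr trunc_agree (hv.trans (eval_le_runBound p hy.1))).symm
  have hadm : ∀ x x', R x x' → ∀ m y, Admissible M p (oracle mach) A x m y →
      Admissible M p (oracle mach) A x' m y := by
    intro x x' hxx' m y hy
    have hfx : f x = f x' := (hR x x').1 hxx'
    obtain ⟨⟨hyc, hmin⟩, hyf⟩ := hy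
    have hyf' : f y = f x := by rw [← hout, ← hout x]; exact hyf
    have hyx : R y x := (hR y x).2 hyf'
    have hyx' : R y x' := (hR y x').2 (hyf'.trans hfx)
    -- The length cutoff depends on `x` and not on its class. This is harmless: `y` lies in the
    -- class, so `y` and all words of smaller rank are within the cutoffs of both `x` and `x'`.
    refine ⟨⟨⟨(hp _ _ hyx').trans (Nat.le_add_right _ _), ?_⟩, ?_⟩, ?_⟩
    · rw [hyc.2, hout, hout, hfx]
    · intro y' hy'
      by_contra! hlt
      refine absurd (hmin y' ⟨?_, ?_⟩) (not_le.2 hlt)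
      · exact ((length_le_of_rank_le hlt.le).trans (hp _ _ hyx)).trans (Nat.le_add_right _ _)
      · rw [hy'.2, hout, hout, hfx]
    · rw [hout, hout, hyf', hfx]
  have hcan : ∀ x, R x (canon M p (oracle mach) A x) := by
    intro x
    obtain ⟨y, hy⟩ := hex x
    rw [hy.canon_eq]
    obtain ⟨m, hm, -⟩ := hy
    have := hm.2
    rw [hout, hout] at this
    exact (hR _ _).2 this.symm
  have hinv : ∀ x x', R x x' → canon M p (oracle mach) A x = canon M p (oracle mach) A x' := by
    intro x x' h
    have : Admissible M p (oracle mach) A x = Admissible M p (oracle mach) A x' := by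
      funext m y
      exact propext ⟨hadm x x' h m y, hadm x' x (R.symm h) m y⟩
    unfold canon IsCanonical
    rw [this]
  refine ⟨_, task_mem_FP mach A (c + 2), ?_, ?_⟩
  · intro x x'
    simp only [htask]
    exact ⟨hinv x x', fun h => R.trans (hcan x) (h ▸ R.symm (hcan x'))⟩
  · intro x
    simp only [htask]
    exact hcan x

end Oracle

/-! ### Generic hidden data -/

/-- All words in `A` are shorter than `n`. -/
def IsBelow (n : ℕ) (A : Hidden) : Prop := ∀ f, ∀ w ∈ A f, w.length < n

/-- `A` and `A'` contain the same words of length less than `n`. -/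
def Agree (n : ℕ) (A A' : Hidden) : Prop :=
  ∀ f, ∀ w : List Bool, w.length < n → (w ∈ A' f ↔ w ∈ A f)

theorem Agree.trans {m n : ℕ} {A B D : Hidden} (h : Agree m A B) (hmn : m ≤ n)
    (h' : Agree n B D) : Agree m A D :=
  fun f w hw => (h' f w (hw.trans_le hmn)).trans (h f w hw)

/-- Countably many requirements can be met if each of them can be forced by a finite extension. -/
theorem exists_hidden {ι : Type*} [Countable ι] [Nonempty ι] (Good : ι → Hidden → Prop)
    (ext : ∀ j A N, IsBelow N A → ∃ A' N', N ≤ N' ∧ IsBelow N' A' ∧ Agree N A A' ∧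
      ∀ A'', Agree N' A' A'' → Good j A'') : ∃ A, ∀ j, Good j A := by
  obtain ⟨e, he⟩ := exists_surjective_nat ι
  have ext' : ∀ j, ∀ s : {q : Hidden × ℕ // IsBelow q.2 q.1},
      ∃ s' : {q : Hidden × ℕ // IsBelow q.2 q.1}, s.1.2 ≤ s'.1.2 ∧ Agree s.1.2 s.1.1 s'.1.1 ∧
        ∀ A'', Agree s'.1.2 s'.1.1 A'' → Good j A'' := by
    rintro j ⟨⟨A, N⟩, h⟩
    obtain ⟨A', N', h1, h2, h3, h4⟩ := ext j A N h
    exact ⟨⟨⟨A', N'⟩, h2⟩, h1, h3, h4⟩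
  choose g hg1 hg2 hg3 using ext'
  let s : ℕ → {q : Hidden × ℕ // IsBelow q.2 q.1} := fun k =>
    Nat.rec ⟨⟨fun _ => ∅, 0⟩, fun _ w hw => hw.elim⟩ (fun k r => g (e k) r) k
  have hs : ∀ k, s (k + 1) = g (e k) (s k) := fun _ => rfl
  have hagree : ∀ k d, (s k).1.2 ≤ (s (k + d)).1.2 ∧
      Agree (s k).1.2 (s k).1.1 (s (k + d)).1.1 := by
    intro k d
    induction d with
    | zero => exact ⟨le_rfl, fun _ _ _ => Iff.rfl⟩
    | succ d ih =>
      rw [← Nat.add_assoc, hs]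
      exact ⟨ih.1.trans (hg1 _ _), ih.2.trans ih.1 (hg2 _ _)⟩
  refine ⟨fun f => {w | ∃ k, w ∈ (s k).1.1 f}, fun j => ?_⟩
  obtain ⟨k, rfl⟩ := he j
  refine hg3 (e k) (s k) _ ?_
  rw [← hs]
  intro f w hw
  refine ⟨?_, fun h => ⟨k + 1, h⟩⟩
  rintro ⟨l, hl⟩
  rcases le_total l (k + 1) with h | h
  · obtain ⟨d, hd⟩ := Nat.exists_eq_add_of_le h
    rw [hd]
    exact ((hagree l d).2 f w ((s l).2 f w hl)).2 hl
  · obtain ⟨d, rfl⟩ := Nat.exists_eq_add_of_le h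
    exact ((hagree (k + 1) d).2 f w hw).1 hl

/-- Add the words `a` and `b` to `A f`. -/
def addPair (A : Hidden) (f : Bool) (a b : List Bool) : Hidden :=
  fun g => {w | w ∈ A g ∨ g = f ∧ (w = a ∨ w = b)}

theorem addPair_comm (A : Hidden) (f : Bool) (a b : List Bool) :
    addPair A f a b = addPair A f b a := by
  funext g
  ext w
  exact or_congr_right (and_congr_right fun _ => or_comm)

theorem mem_addPair {A : Hidden} {f g : Bool} {a b w : List Bool} :
    w ∈ addPair A f a b g ↔ w ∈ A g ∨ g = f ∧ (w = a ∨ w = b) := Iff.rfl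

theorem IsBelow.mono {m n : ℕ} {A : Hidden} (h : IsBelow m A) (hmn : m ≤ n) : IsBelow n A :=
  fun f w hw => (h f w hw).trans_le hmn

section AddPair

variable {n : ℕ} {A : Hidden} {a b : List Bool} (f : Bool)

theorem agree_addPair (A : Hidden) (ha : a.length = n) (hb : b.length = n) :
    Agree n A (addPair A f a b) := by
  intro g w hw
  rw [mem_addPair]
  refine or_iff_left ?_
  rintro ⟨-, rfl | rfl⟩ <;> omega

theorem IsBelow.addPair (h : IsBelow n A) (ha : a.length = n) (hb : b.length = n) :
    IsBelow (n + 1) (addPair A f a b) := by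
  rintro g w (hw | ⟨-, rfl | rfl⟩)
  · have := h g w hw
    omega
  · omega
  · omega

theorem mem_addPair_of_length (h : IsBelow n A) {w : List Bool} (hw : w.length = n) :
    w ∈ EqProblems.addPair A f a b f ↔ w = a ∨ w = b := by
  rw [mem_addPair]
  constructor
  · rintro (h' | ⟨-, h'⟩)
    · have := h f w h'
      omega
    · exact h'
  · exact fun h' => Or.inr ⟨rfl, h'⟩

theorem trunc_addPair (A : Hidden) (ha : a.length = n) (hb : b.length = n) {m : ℕ}
    (hm : m ≤ n) : trunc m (EqProblems.addPair A f a b) = trunc m A := by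
  funext g
  ext w
  refine and_congr_left fun hw => ?_
  exact agree_addPair f A ha hb g w (by omega)

theorem trunc_eq_self (h : IsBelow n A) : trunc n A = A := by
  funext g
  ext w
  exact and_iff_left_of_imp (h g w)

end AddPair

/-! ### Counting -/

/-- Otherwise the diagonal, the pairs `(a, b)` with `b ∈ D a`, and their transposes cover `V × V`,
whence `|V| ^ 2 ≤ |V| + 2 * |V| * K`. -/
theorem exists_mutually_avoiding {V : Type*} [Fintype V] (D : V → Finset V) {K : ℕ}
    (hD : ∀ a, (D a).card ≤ K) (hK : 2 * K + 1 < Fintype.card V) :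
    ∃ a b, a ≠ b ∧ b ∉ D a ∧ a ∉ D b := by
  classical
  by_contra! h
  let S : Finset (V × V) := Finset.univ.biUnion fun a => (D a).image fun b => (a, b)
  have hS : S.card ≤ Fintype.card V * K :=
    Finset.card_biUnion_le_card_mul _ _ K fun a _ => Finset.card_image_le.trans (hD a)
  have hsub : (Finset.univ : Finset (V × V)) ⊆
      (Finset.univ.image fun a => (a, a)) ∪ (S ∪ S.image Prod.swap) := by
    rintro ⟨a, b⟩ -
    have hmem : ∀ a b, b ∈ D a → (a, b) ∈ S := fun a b hb =>
      Finset.mem_biUnion.2 ⟨a, Finset.mem_univ _, Finset.mem_image.2 ⟨b, hb, rfl⟩⟩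
    simp only [Finset.mem_union, Finset.mem_image, Finset.mem_univ, true_and]
    by_cases hab : a = b
    · exact Or.inl ⟨a, by rw [hab]⟩
    · by_cases hb : b ∈ D a
      · exact Or.inr (Or.inl (hmem a b hb))
      · exact Or.inr (Or.inr ⟨(b, a), hmem b a (h a b hab hb), rfl⟩)
  have h1 := (Finset.card_le_card hsub).trans (Finset.card_union_le _ _)
  have h2 := Finset.card_union_le S (S.image Prod.swap)
  have h3 : (S.image Prod.swap).card ≤ S.card := Finset.card_image_le
  have h4 : (Finset.univ.image fun a : V => (a, a)).card ≤ Fintype.card V := Finset.card_image_le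
  rw [Finset.card_univ, Fintype.card_prod] at h1
  nlinarith

theorem exists_eval_lt_two_pow (q : Polynomial ℕ) (N : ℕ) : ∃ n, N ≤ n ∧ q.eval n < 2 ^ n := by
  have h : (fun n : ℕ => ((q.eval n : ℕ) : ℝ)) =o[Filter.atTop] fun n : ℕ => (2 : ℝ) ^ n := by
    induction q using Polynomial.induction_on' with
    | add p q hp hq => simpa using hp.add hq
    | monomial k a =>
      simpa using (isLittleO_pow_const_const_pow_of_one_lt k one_lt_two).const_mul_left (a : ℝ)
  have h1 := (h.bound (show (0 : ℝ) < 1 / 2 by norm_num)).and (Filter.eventually_ge_atTop N)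
  obtain ⟨n, hn, hN⟩ := h1.exists
  refine ⟨n, hN, ?_⟩
  have h2 : (0 : ℝ) < 2 ^ n := by positivity
  rw [Real.norm_of_nonneg (by positivity), Real.norm_of_nonneg h2.le] at hn
  have : ((q.eval n : ℕ) : ℝ) < 2 ^ n := by linarith
  exact_mod_cast this

/-! ### Stability of the oracle bits -/

variable {mach : ℕ → Option (OracleTM × Polynomial ℕ)}

theorem code_mem_oracle_congr {A A' : Hidden} {c i : ℕ} {x : List Bool}
    (h : (delay mach c).eval x.length < i →
      task mach (oracle mach) A' x c = task mach (oracle mach) A x c) :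
    code c x i ∈ oracle mach A' ↔ code c x i ∈ oracle mach A := by
  rw [code_mem_oracle, code_mem_oracle]
  by_cases hi : i ≤ (delay mach c).eval x.length
  · rw [script_of_le hi]
  · rw [h (not_le.1 hi)]

theorem task_one_congr {P P' : Hidden → Set (List Bool)} {A A' : Hidden} {x : List Bool}
    (h : x ∈ A' true ↔ x ∈ A true) : task mach P' A' x 1 = task mach P A x 1 := by
  classical
  exact if_congr h rfl rfl

theorem task_zero_congr {P P' : Hidden → Set (List Bool)} {A A' : Hidden} {x : List Bool}
    (h : ∀ y z, x = pair y z → (hiddenRel A' false y z ↔ hiddenRel A false y z)) :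
    task mach P' A' x 0 = task mach P A x 0 := by
  classical
  exact if_congr (exists_congr fun y => exists_congr fun z => and_congr_right (h y z)) rfl rfl

/-- The input asks about at most one pair of words, which can be affected only by adding that pair,
in either order. -/
theorem task_zero_addPair {P P' : Hidden → Set (List Bool)} {n : ℕ} {A : Hidden}
    (hA : IsBelow n A) (x : List Bool) : ∃ C : Finset (List.Vector Bool n × List.Vector Bool n),
      C.card ≤ 2 ∧ ∀ v ∉ C, task mach P' (addPair A false v.1.1 v.2.1) x 0 = task mach P A x 0 := by
  classical
  have key : ∀ v : List.Vector Bool n × List.Vector Bool n, x ≠ pair v.1.1 v.2.1 →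
      x ≠ pair v.2.1 v.1.1 →
      task mach P' (addPair A false v.1.1 v.2.1) x 0 = task mach P A x 0 := by
    rintro ⟨⟨a, ha⟩, ⟨b, hb⟩⟩ h1 h2
    simp only at h1 h2 ⊢
    refine task_zero_congr fun y z hx => ?_
    rw [hiddenRel_iff, hiddenRel_iff]
    refine or_congr_right' fun hyz => and_congr_right fun hl => ?_
    by_cases hy : y.length = n
    · rw [mem_addPair_of_length false hA hy, mem_addPair_of_length false hA (hl ▸ hy)]
      constructor
      · rintro ⟨rfl | rfl, rfl | rfl⟩
        · exact (hyz rfl).elim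
        · exact (h1 hx).elim
        · exact (h2 hx).elim
        · exact (hyz rfl).elim
      · rintro ⟨h, -⟩
        have := hA _ _ h
        omega
    · have h : ∀ w : List Bool, w.length ≠ n →
          (w ∈ addPair A false a b false ↔ w ∈ A false) := by
        intro w hw
        rw [mem_addPair]
        refine or_iff_left ?_
        rintro ⟨-, rfl | rfl⟩ <;> exact hw (by assumption)
      rw [h y hy, h z (hl ▸ hy)]
  by_cases hx : ∃ v : List.Vector Bool n × List.Vector Bool n, x = pair v.1.1 v.2.1
  · obtain ⟨⟨a, b⟩, rfl⟩ := hx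
    refine ⟨{(a, b), (b, a)}, Finset.card_le_two, fun v hv => key v ?_ ?_⟩
    · intro h
      obtain ⟨h1, h2⟩ := pair_injective h
      exact hv (by simp [Prod.ext_iff, ← Subtype.ext h1, ← Subtype.ext h2])
    · intro h
      obtain ⟨h1, h2⟩ := pair_injective h
      exact hv (by simp [Prod.ext_iff, ← Subtype.ext h1, ← Subtype.ext h2])
  · push Not at hx
    exact ⟨∅, by simp, fun v _ => key v (hx v) (hx v.swap)⟩

/-- The canonical word of `x` is the same for almost all ways to add a pair of words. -/
theorem canon_addPair {n : ℕ} {A : Hidden} (hA : IsBelow n A) (M : OracleTM) (p : Polynomial ℕ)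
    (x : List Bool) {K : ℕ}
    (h : ∀ u : List Bool, u.length ≤ (runBound p).eval x.length →
      ∃ C : Finset (List.Vector Bool n × List.Vector Bool n), C.card ≤ K ∧
        ∀ v ∉ C, (u ∈ oracle mach (addPair A false v.1.1 v.2.1) ↔ u ∈ oracle mach A)) :
    ∃ C : Finset (List.Vector Bool n × List.Vector Bool n),
      C.card ≤ (n + 2) * ((runBound p).eval x.length * K) ∧
      ∀ v ∉ C, canon M p (oracle mach) (addPair A false v.1.1 v.2.1) x =
        canon M p (oracle mach) A x := by
  classical
  set s := (runBound p).eval x.length with hs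
  have hrun : ∀ y : List Bool, y.length ≤ p.eval x.length + x.length →
      ∃ C : Finset (List.Vector Bool n × List.Vector Bool n), C.card ≤ s * K ∧
        ∀ v ∉ C, M.out (oracle mach (addPair A false v.1.1 v.2.1)) (p.eval y.length) y =
          M.out (oracle mach A) (p.eval y.length) y := by
    intro y hy
    have hps := eval_le_runBound p hy
    obtain ⟨C, hC, hCv⟩ := M.run_stable (oracle mach A)
      (fun v : List.Vector Bool n × List.Vector Bool n =>
        oracle mach (addPair A false v.1.1 v.2.1)) (t := p.eval y.length) (K := K)
      (fun u hu => h u (hu.trans hps)) y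
    exact ⟨C, hC.trans (Nat.mul_le_mul_right _ hps),
      fun v hv => OracleTM.out_eq_of_run_eq (hCv v hv)⟩
  -- The first candidate at `m` is unique, so a single run per `m` has to be stable.
  have hbest : ∀ m, ∃ C : Finset (List.Vector Bool n × List.Vector Bool n), C.card ≤ s * K ∧
      ∀ v ∉ C, ∀ y, (y ∈ candidates M p (oracle mach) A x m ∧
        ∀ y' ∈ candidates M p (oracle mach) A x m, rank y ≤ rank y') →
        M.out (oracle mach (addPair A false v.1.1 v.2.1)) (p.eval y.length) y =
          M.out (oracle mach A) (p.eval y.length) y := by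
    intro m
    by_cases hy : ∃ y, y ∈ candidates M p (oracle mach) A x m ∧
        ∀ y' ∈ candidates M p (oracle mach) A x m, rank y ≤ rank y'
    · obtain ⟨y, hy, hmin⟩ := hy
      obtain ⟨C, hC, hCv⟩ := hrun y hy.1
      refine ⟨C, hC, fun v hv y' hy' => ?_⟩
      obtain rfl := rank_injective (le_antisymm (hmin y' hy'.1) (hy'.2 y hy))
      exact hCv v hv
    · exact ⟨∅, by simp, fun v _ y hy' => (hy ⟨y, hy'⟩).elim⟩
  obtain ⟨Cx, hCx, hx⟩ := hrun x (by omega)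
  choose Cm hCm hm using hbest
  refine ⟨Cx ∪ (Finset.range (n + 1)).biUnion Cm, ?_, ?_⟩
  · have h1 := Finset.card_union_le Cx ((Finset.range (n + 1)).biUnion Cm)
    have h2 := Finset.card_biUnion_le_card_mul (Finset.range (n + 1)) Cm (s * K)
      fun m _ => hCm m
    rw [Finset.card_range] at h2
    linarith
  · intro v hv
    simp only [Finset.mem_union, Finset.mem_biUnion, Finset.mem_range, not_or, not_exists,
      not_and] at hv
    obtain ⟨hvx, hvm⟩ := hv
    -- Truncation at `m ≤ n` removes the added pair, so the candidates depend on it only through the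
    -- output at `x`.
    have hcand : ∀ m ≤ n, candidates M p (oracle mach) (addPair A false v.1.1 v.2.1) x m =
        candidates M p (oracle mach) A x m := by
      intro m hmn
      unfold candidates
      rw [trunc_addPair false A v.1.2 v.2.2 hmn, hx v hvx]
    have hadm : ∀ m ≤ n, ∀ y,
        Admissible M p (oracle mach) (addPair A false v.1.1 v.2.1) x m y ↔
          Admissible M p (oracle mach) A x m y := by
      intro m hmn y
      unfold Admissible
      rw [hcand m hmn]
      refine and_congr_right fun hy => ?_
      rw [hm m v (hvm m (by omega)) y hy, hx v hvx]
    -- Truncation at `n` does not change `A`; hence the search over `A` ends at some `m ≤ n`, for an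
    -- arbitrary machine.
    have hxn : x ∈ candidates M p (oracle mach) A x n := by
      refine ⟨by omega, ?_⟩
      rw [trunc_eq_self hA]
    obtain ⟨y, hy, hmin⟩ := exists_minimal_rank ⟨x, hxn⟩
    have hyn : Admissible M p (oracle mach) A x n y := by
      refine ⟨⟨hy, hmin⟩, ?_⟩
      have := hy.2
      rwa [trunc_eq_self hA] at this
    obtain ⟨w, m, hw, hlt⟩ := exists_isCanonical ⟨n, y, hyn⟩
    have hmn : m ≤ n := not_lt.1 fun h' => hlt n h' y hyn
    have h1 : IsCanonical M p (oracle mach) A x w := ⟨m, hw, hlt⟩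
    have h2 : IsCanonical M p (oracle mach) (addPair A false v.1.1 v.2.1) x w :=
      ⟨m, (hadm m hmn w).2 hw, fun m' hm' y' hy' =>
        hlt m' hm' y' ((hadm m' (by omega) y').1 hy')⟩
    rw [h1.canon_eq, h2.canon_eq]

/-- Each oracle bit is the same for almost all ways to add a pair of words of length `n` to
`A false`. -/
theorem oracle_addPair_false {n : ℕ} {A : Hidden} (hA : IsBelow n A) (u : List Bool) :
    ∃ C : Finset (List.Vector Bool n × List.Vector Bool n), C.card ≤ u.length ^ 2 + 2 ∧
      ∀ v ∉ C, (u ∈ oracle mach (addPair A false v.1.1 v.2.1) ↔ u ∈ oracle mach A) := by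
  induction hl : u.length using Nat.strong_induction_on generalizing u with
  | _ l ih =>
  subst hl
  by_cases hun : u.length ≤ n
  · exact ⟨∅, by simp, fun v _ =>
      oracle_congr (agree_addPair false A v.1.2 v.2.2) hun⟩
  by_cases hcode : ∃ c x i, u = code c x i
  swap
  · exact ⟨∅, by simp, fun v _ =>
      ⟨fun h' => (hcode (exists_code_of_mem_oracle h')).elim,
        fun h' => (hcode (exists_code_of_mem_oracle h')).elim⟩⟩
  obtain ⟨c, x, i, rfl⟩ := hcode
  match c with
  | 0 =>
    obtain ⟨C, hC, h⟩ := task_zero_addPair (mach := mach) (P := oracle mach) (P' := oracle mach)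
      hA x
    exact ⟨C, by omega, fun v hv => code_mem_oracle_congr fun _ => h v hv⟩
  | 1 =>
    refine ⟨∅, by simp, fun v _ => code_mem_oracle_congr fun _ => task_one_congr ?_⟩
    rw [mem_addPair]
    simp
  | c + 2 =>
    match hc : mach c with
    | none => exact ⟨∅, by simp, fun v _ => code_mem_oracle_congr fun _ => by simp [task, hc]⟩
    | some (M, p) =>
      by_cases hi : (delay mach (c + 2)).eval x.length < i
      swap
      · exact ⟨∅, by simp, fun v _ => code_mem_oracle_congr fun h => (hi h).elim⟩
      have h1 := runBound_lt_of_delay_lt hc hi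
      set s := (runBound p).eval x.length with hs
      set l := (code (c + 2) x i).length with hl
      have h2 := le_delay_aux s
      obtain ⟨C, hC, h⟩ := canon_addPair (mach := mach) hA M p x (K := s ^ 2 + 2) (by
        intro u hu
        rw [← hs] at hu
        obtain ⟨C, hC, h⟩ := ih u.length (by omega) u rfl
        exact ⟨C, hC.trans (Nat.add_le_add_right (Nat.pow_le_pow_left hu 2) 2), h⟩)
      refine ⟨C, hC.trans ?_, fun v hv => code_mem_oracle_congr fun _ => ?_⟩
      · rw [← hs]
        -- The count `(n + 2) * k` is at most `(l + 1) * l / 3`, hence at most `l ^ 2 + 2`: this is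
        -- where the factor `3` in `delay` and the case `n < l` are used.
        have h3 : n + 2 ≤ l + 1 := by omega
        have h4 : 3 * (s * (s ^ 2 + 2)) ≤ l := by rw [← mul_assoc]; exact h1.le
        generalize s * (s ^ 2 + 2) = k at h4 ⊢
        nlinarith
      · simp only [task, hc, Option.elim_some]
        exact h v hv

/-- Without machines, each oracle bit is the same for almost all ways to add a second word of
length `n` to `A true`. -/
theorem oracle_addPair_true {n : ℕ} {A : Hidden} (a : List Bool) (u : List Bool) :
    ∃ C : Finset (List.Vector Bool n), C.card ≤ 1 ∧
      ∀ v ∉ C, (u ∈ oracle (fun _ => none) (addPair A true a v.1) ↔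
        u ∈ oracle (fun _ => none) (addPair A true a a)) := by
  classical
  by_cases hcode : ∃ c x i, u = code c x i
  swap
  · exact ⟨∅, by simp, fun v _ =>
      ⟨fun h' => (hcode (exists_code_of_mem_oracle h')).elim,
        fun h' => (hcode (exists_code_of_mem_oracle h')).elim⟩⟩
  obtain ⟨c, x, i, rfl⟩ := hcode
  match c with
  | 0 =>
    refine ⟨∅, by simp, fun v _ => code_mem_oracle_congr fun _ => task_zero_congr fun y z _ => ?_⟩
    simp [hiddenRel_iff, mem_addPair]
  | 1 =>
    -- The oracle is compared with the one where `a` alone is added, since the machine may query its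
    -- own input `a`; the bit at `x` then changes only if the partner is `x`.
    refine ⟨Finset.univ.filter fun v => v.1 = x, ?_, fun v hv =>
      code_mem_oracle_congr fun _ => task_one_congr ?_⟩
    · refine Finset.card_le_one.2 fun v hv w hw => Subtype.ext ?_
      rw [(Finset.mem_filter.1 hv).2, (Finset.mem_filter.1 hw).2]
    · have hv' : ¬ x = v.1 := fun h => hv (by simp [h])
      simp [mem_addPair, hv']
  | c + 2 => exact ⟨∅, by simp, fun v _ => code_mem_oracle_congr fun _ => rfl⟩

/-! ### The requirements -/

/-- With time bound `p`, the machine does not compute a complete invariant of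
`hiddenRel A false`. -/
def AvoidsKer (mach : ℕ → Option (OracleTM × Polynomial ℕ)) (M : OracleTM) (p : Polynomial ℕ)
    (A : Hidden) : Prop :=
  ¬ ∃ f : List Bool → List Bool, (∀ x, M.Outputs (oracle mach A) (p.eval x.length) x (f x)) ∧
    IsCompleteInvariant (hiddenRel A false) f

/-- With time bound `p`, the machine does not compute a canonical form of `hiddenRel A true`. -/
def AvoidsCF (mach : ℕ → Option (OracleTM × Polynomial ℕ)) (M : OracleTM) (p : Polynomial ℕ)
    (A : Hidden) : Prop :=
  ¬ ∃ f : List Bool → List Bool, (∀ x, M.Outputs (oracle mach A) (p.eval x.length) x (f x)) ∧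
    IsCanonicalForm (hiddenRel A true) f

theorem out_congr_of_agree {A A' : Hidden} {T t : ℕ} (h : Agree T A A') (ht : t ≤ T)
    (M : OracleTM) (x : List Bool) :
    M.out (oracle mach A') t x = M.out (oracle mach A) t x :=
  OracleTM.out_eq_of_run_eq (M.run_congr (fun _ hv => oracle_congr h (hv.trans ht)) x)

/-- Two words of length `n` are found on which the runs cannot tell whether the pair has been added;
the decision to add it is then made against the outputs. -/
theorem exists_extension_avoidsKer (M : OracleTM) (p : Polynomial ℕ) (A : Hidden) (N : ℕ)
    (hA : IsBelow N A) : ∃ A' N', N ≤ N' ∧ IsBelow N' A' ∧ Agree N A A' ∧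
      ∀ A'', Agree N' A' A'' → AvoidsKer mach M p A'' := by
  classical
  -- A run has at most `t * (t ^ 2 + 2)` exceptional pairs; both coordinates are to be avoided,
  -- which doubles this to `K`, and `2 * K + 1 < 2 ^ n` is required.
  obtain ⟨n, hNn, hn⟩ := exists_eval_lt_two_pow (4 * (p * (p ^ 2 + 2)) + 1) N
  simp only [Polynomial.eval_add, Polynomial.eval_mul, Polynomial.eval_pow,
    Polynomial.eval_ofNat, Polynomial.eval_one] at hn
  set t := p.eval n with ht
  have hAn := hA.mono hNn
  have hcert : ∀ a : List.Vector Bool n,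
      ∃ C : Finset (List.Vector Bool n × List.Vector Bool n), C.card ≤ t * (t ^ 2 + 2) ∧
        ∀ v ∉ C, M.run (oracle mach (addPair A false v.1.1 v.2.1)) t a.1 =
          M.run (oracle mach A) t a.1 := fun a =>
    M.run_stable (oracle mach A) (fun v : List.Vector Bool n × List.Vector Bool n =>
      oracle mach (addPair A false v.1.1 v.2.1)) (t := t) (K := t ^ 2 + 2) (fun u hu => by
        obtain ⟨C, hC, h⟩ := oracle_addPair_false (mach := mach) hAn u
        exact ⟨C, hC.trans (Nat.add_le_add_right (Nat.pow_le_pow_left hu 2) 2), h⟩) a.1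
  choose C hC hrun using hcert
  obtain ⟨a, b, hab, hb, ha⟩ := exists_mutually_avoiding
    (fun a => (C a).image Prod.fst ∪ (C a).image Prod.snd) (K := 2 * (t * (t ^ 2 + 2)))
    (fun a => by
      have h1 : ((C a).image Prod.fst).card ≤ (C a).card := Finset.card_image_le
      have h2 : ((C a).image Prod.snd).card ≤ (C a).card := Finset.card_image_le
      have h3 := Finset.card_union_le ((C a).image Prod.fst) ((C a).image Prod.snd)
      have h4 := hC a
      omega)
    (by rw [card_vector, Fintype.card_bool]; omega)
  have hCa : (a, b) ∉ C a := fun h => hb (Finset.mem_union_right _ (Finset.mem_image_of_mem _ h))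
  have hCb : (a, b) ∉ C b := fun h => ha (Finset.mem_union_left _ (Finset.mem_image_of_mem _ h))
  have hab' : a.1 ≠ b.1 := fun h => hab (Subtype.ext h)
  have hla : a.1.length = n := a.2
  have hlb : b.1.length = n := b.2
  obtain ⟨A', hbel, hagr, hout, hrel⟩ : ∃ A', IsBelow (n + 1) A' ∧ Agree n A A' ∧
      (∀ w ∈ ({a, b} : Set (List.Vector Bool n)),
        M.out (oracle mach A') t w.1 = M.out (oracle mach A) t w.1) ∧
      (a.1 ∈ A' false ∧ b.1 ∈ A' false ↔
        M.out (oracle mach A) t a.1 ≠ M.out (oracle mach A) t b.1) := by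
    by_cases h : M.out (oracle mach A) t a.1 = M.out (oracle mach A) t b.1
    · refine ⟨A, hAn.mono (by omega), fun _ _ _ => Iff.rfl, fun _ _ => rfl, ?_⟩
      refine ⟨fun h' => ?_, fun h' => (h' h).elim⟩
      have := hAn _ _ h'.1
      omega
    · refine ⟨addPair A false a.1 b.1, hAn.addPair false hla hlb,
        agree_addPair false A hla hlb, ?_, ?_⟩
      · rintro w (rfl | rfl)
        · exact OracleTM.out_eq_of_run_eq (hrun w _ hCa)
        · exact OracleTM.out_eq_of_run_eq (hrun _ _ hCb)
      · exact iff_of_true ⟨Or.inr ⟨rfl, Or.inl rfl⟩, Or.inr ⟨rfl, Or.inr rfl⟩⟩ h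
  -- Agreement below `n + 1` fixes the status of `a` and `b`; agreement below `t` fixes the two
  -- runs.
  refine ⟨A', max (n + 1) t, by omega, hbel.mono (le_max_left _ _),
    fun f w hw => hagr f w (by omega), fun A'' hA'' => ?_⟩
  rintro ⟨f, hf, hinv⟩
  have hfa : f a.1 = M.out (oracle mach A) t a.1 := by
    rw [← hout a (Or.inl rfl), ← out_congr_of_agree hA'' (le_max_right _ _), ht]
    have := (hf a.1).out_eq
    rw [hla] at this
    exact this.symm
  have hfb : f b.1 = M.out (oracle mach A) t b.1 := by
    rw [← hout b (Or.inr rfl), ← out_congr_of_agree hA'' (le_max_right _ _), ht]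
    have := (hf b.1).out_eq
    rw [hlb] at this
    exact this.symm
  have h1 := hinv a.1 b.1
  rw [hiddenRel_iff, hA'' false a.1 (by omega), hA'' false b.1 (by omega), hrel, hfa, hfb] at h1
  rw [or_iff_right hab', and_iff_right (hla.trans hlb.symm)] at h1
  exact iff_not_self h1.symm

/-- The run on `a` behaves as if `a` were alone and does not output `b`, and vice versa. The common
value of the canonical form on the class `{a, b}` is therefore neither word. -/
theorem exists_extension_avoidsCF (M : OracleTM) (p : Polynomial ℕ) (A : Hidden) (N : ℕ)
    (hA : IsBelow N A) : ∃ A' N', N ≤ N' ∧ IsBelow N' A' ∧ Agree N A A' ∧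
      ∀ A'', Agree N' A' A'' → AvoidsCF (fun _ => none) M p A'' := by
  classical
  obtain ⟨n, hNn, hn⟩ := exists_eval_lt_two_pow (2 * (p + 1) + 1) N
  simp only [Polynomial.eval_add, Polynomial.eval_mul, Polynomial.eval_ofNat,
    Polynomial.eval_one] at hn
  set t := p.eval n with ht
  have hAn := hA.mono hNn
  have hcert : ∀ a : List.Vector Bool n, ∃ C : Finset (List.Vector Bool n), C.card ≤ t * 1 ∧
      ∀ v ∉ C, M.run (oracle (fun _ => none) (addPair A true a.1 v.1)) t a.1 =
        M.run (oracle (fun _ => none) (addPair A true a.1 a.1)) t a.1 := fun a =>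
    M.run_stable _ (fun v : List.Vector Bool n => oracle (fun _ => none) (addPair A true a.1 v.1))
      (fun u _ => oracle_addPair_true a.1 u) a.1
  choose C hC hrun using hcert
  let o : List.Vector Bool n → List Bool := fun a =>
    M.out (oracle (fun _ => none) (addPair A true a.1 a.1)) t a.1
  obtain ⟨a, b, hab, hb, ha⟩ := exists_mutually_avoiding
    -- The extra element to be avoided is the output on `a`, so that the partner is not named.
    (fun a => C a ∪ Finset.univ.filter fun v => v.1 = o a) (K := t + 1)
    (fun a => by
      have h1 : (Finset.univ.filter fun v : List.Vector Bool n => v.1 = o a).card ≤ 1 := by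
        refine Finset.card_le_one.2 fun v hv w hw => Subtype.ext ?_
        rw [(Finset.mem_filter.1 hv).2, (Finset.mem_filter.1 hw).2]
      have h3 := Finset.card_union_le (C a) (Finset.univ.filter fun v => v.1 = o a)
      have h4 := hC a
      omega)
    (by rw [card_vector, Fintype.card_bool]; exact hn)
  simp only [Finset.mem_union, Finset.mem_filter, Finset.mem_univ, true_and, not_or] at ha hb
  have hla : a.1.length = n := a.2
  have hlb : b.1.length = n := b.2
  refine ⟨addPair A true a.1 b.1, max (n + 1) t, by omega,
    (hAn.addPair true hla hlb).mono (le_max_left _ _),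
    fun f w hw => agree_addPair true A hla hlb f w (by omega), fun A'' hA'' => ?_⟩
  rintro ⟨f, hf, hinv, hcan⟩
  have hfa : f a.1 = o a := by
    have h1 := (hf a.1).out_eq
    rw [hla, ← ht, out_congr_of_agree hA'' (le_max_right _ _)] at h1
    rw [← h1]
    exact OracleTM.out_eq_of_run_eq (hrun a b hb.1)
  have hfb : f b.1 = o b := by
    have h1 := (hf b.1).out_eq
    rw [hlb, ← ht, out_congr_of_agree hA'' (le_max_right _ _), addPair_comm] at h1
    rw [← h1]
    exact OracleTM.out_eq_of_run_eq (hrun b a ha.1)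
  have hmem : ∀ w : List Bool, w.length = n → (w ∈ A'' true ↔ w = a.1 ∨ w = b.1) := by
    intro w hw
    rw [hA'' true w (by omega), mem_addPair_of_length true hAn hw]
  have hclass : ∀ w : List.Vector Bool n, f w.1 ≠ a.1 → f w.1 ≠ b.1 → f w.1 = w.1 := by
    intro w h1 h2
    rcases hcan w.1 with h | ⟨hl, -, h⟩
    · exact h.symm
    · rcases (hmem _ (hl.symm.trans w.2)).1 h with h | h
      · exact (h1 h).elim
      · exact (h2 h).elim
  have hfab : f a.1 = f b.1 := (hinv a.1 b.1).1 (Or.inr ⟨hla.trans hlb.symm,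
    (hmem _ hla).2 (Or.inl rfl), (hmem _ hlb).2 (Or.inr rfl)⟩)
  have hna : f a.1 ≠ b.1 := fun h => hb.2 (h.symm.trans hfa)
  have hnb : f a.1 ≠ a.1 := fun h => ha.2 (h.symm.trans (hfab.trans hfb))
  exact hnb (hclass a hnb hna)

theorem Ker_ne_PEq_of_avoidsKer {mach : ℕ → Option (OracleTM × Polynomial ℕ)} {A : Hidden}
    (h : ∀ M p, AvoidsKer mach M p A) : Ker (oracle mach A) ≠ PEq (oracle mach A) := by
  intro heq
  have : hiddenRel A false ∈ Ker (oracle mach A) := heq ▸ hiddenRel_false_mem_PEq mach A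
  obtain ⟨f, ⟨M, p, hM⟩, hf⟩ := this
  exact h M p ⟨f, hM, hf⟩

theorem CF_ne_Ker_of_avoidsCF {mach : ℕ → Option (OracleTM × Polynomial ℕ)} {A : Hidden}
    (h : ∀ M p, AvoidsCF mach M p A) : CF (oracle mach A) ≠ Ker (oracle mach A) := by
  intro heq
  have : hiddenRel A true ∈ CF (oracle mach A) := heq ▸ hiddenRel_true_mem_Ker mach A
  obtain ⟨f, ⟨M, p, hM⟩, hf⟩ := this
  exact h M p ⟨f, hM, hf⟩

theorem CFP_eq_KerP_of_surjective {mach : ℕ → Option (OracleTM × Polynomial ℕ)}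
    (hmach : ∀ M p, ∃ c, mach c = some (M, p)) (A : Hidden) :
    CFP (oracle mach A) = KerP (oracle mach A) := by
  apply Set.Subset.antisymm
  · rintro R ⟨⟨f, hf, hR⟩, hp⟩
    exact ⟨⟨f, hf, hR.1⟩, hp⟩
  · rintro R ⟨⟨f, ⟨M, p, hM⟩, hR⟩, q, hq⟩
    -- The sum serves both as a time bound and as a bound for the classes.
    obtain ⟨c, hc⟩ := hmach M (p + q)
    refine ⟨mem_CF_of_mach hc (fun x => (hM x).mono ?_) hR fun x y h => (hq x y h).trans ?_,
      q, hq⟩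
    · rw [Polynomial.eval_add]; omega
    · rw [Polynomial.eval_add]; omega

end EqProblems

theorem mainTheorem7 :
    (∃ O : Set (List Bool),
      EqProblems.CF O ≠ EqProblems.Ker O ∧ EqProblems.Ker O ≠ EqProblems.PEq O) ∧
    (∃ O : Set (List Bool),
      EqProblems.CFP O = EqProblems.KerP O ∧ EqProblems.Ker O ≠ EqProblems.PEq O) := by
  constructor
  -- The Boolean component interleaves the requirements for the two separations.
  · obtain ⟨A, hA⟩ := EqProblems.exists_hidden
      (ι := Bool × EqProblems.OracleTM × Polynomial ℕ)
      (fun j A => if j.1 then EqProblems.AvoidsCF (fun _ => none) j.2.1 j.2.2 A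
        else EqProblems.AvoidsKer (fun _ => none) j.2.1 j.2.2 A)
      (by
        rintro ⟨_ | _, M, p⟩ A N hA
        · simpa using EqProblems.exists_extension_avoidsKer M p A N hA
        · simpa using EqProblems.exists_extension_avoidsCF M p A N hA)
    exact ⟨EqProblems.oracle (fun _ => none) A,
      EqProblems.CF_ne_Ker_of_avoidsCF fun M p => by simpa using hA (true, M, p),
      EqProblems.Ker_ne_PEq_of_avoidsKer fun M p => by simpa using hA (false, M, p)⟩
  · obtain ⟨e, he⟩ := exists_surjective_nat (EqProblems.OracleTM × Polynomial ℕ)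
    obtain ⟨A, hA⟩ := EqProblems.exists_hidden
      (fun (j : EqProblems.OracleTM × Polynomial ℕ) A =>
        EqProblems.AvoidsKer (fun c => some (e c)) j.1 j.2 A)
      (fun j => EqProblems.exists_extension_avoidsKer j.1 j.2)
    refine ⟨EqProblems.oracle (fun c => some (e c)) A,
      EqProblems.CFP_eq_KerP_of_surjective (fun M p => ?_) A,
      EqProblems.Ker_ne_PEq_of_avoidsKer fun M p => hA (M, p)⟩
    obtain ⟨c, hc⟩ := he (M, p)
    exact ⟨c, congrArg some hc⟩
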